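/- Let $n\ge 3$ and let $\Gamma(B_n)$ be the graph with vertex set $S_n$ in which $\sigma,\tau$ are adjacent iff $\tau=\sigma s_k$ for some simple transposition $s_k=(k\ \,k+1)$, $1\le k\le n-1$. The *level* of $\sigma\in S_n$ is $\sigma^{-1}(n)$. A 6-cycle of $\Gamma(B_n)$ is *primitive* if it is not the concatenation of two 4-cycles, that is, if its edge set is not the symmetric difference of the edge sets of two 4-cycles. A *vertical 6-cycle at level $i$* is a primitive 6-cycle with exactly two vertices in each of the levels $i-1$, $i$, $i+1$. Fix a base vertex $\sigma_0$. A loop based at $\sigma_0$ is a sequence $f(0),f(1),f(2),\dots$ of vertices, with consecutive terms equal or adjacent, such that $f(0)=\sigma_0$ and $f(m)=\sigma_0$ for all large $m$. Two based loops $f,g$ are *$G$-homotopic* if there are $k\ge 0$ and an array $F(m,j)$ ($m\ge 0$, $0\le j\le k$) of vertices such that entries in neighbouring positions (horizontally or vertically) are equal or adjacent, every row $F(\cdot,j)$ is a loop based at $\sigma_0$, $F(\cdot,0)=f$ and $F(\cdot,k)=g$. Two 6-cycles $C_1,C_2$ are *$G$-homotopic* if there are walks $P_1,P_2$ from $\sigma_0$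 to vertices of $C_1,C_2$ such that the based loops $P_1C_1P_1^{-1}$ and $P_2C_2P_2^{-1}$ are $G$-homotopic, where each $C_r$ is traversed once, in one of its two directions, from the end of $P_r$. Then for every $2\le i\le n-1$ the number of $G$-homotopy classes of vertical 6-cycles at level $i$ of $\Gamma(B_n)$ is $$\frac{(n-1)!}{2\,(i-2)!\,(n-i-1)!}=\binom{n-1}{i}\binom{i}{2}.$$ The total number of $G$-homotopy classes of vertical 6-cycles of $\Gamma(B_n)$ is the sum of these numbers over $2\le i\le n-1$, and it equals $2^{n-3}\binom{n-1}{2}$. -/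

import Mathlib

namespace DiscreteHomotopy

open SimpleGraph

/-- A graph map: adjacent vertices are sent to adjacent or equal vertices. -/
def IsGraphMap {V W : Type*} (G : SimpleGraph V) (H : SimpleGraph W) (f : V → W) : Prop :=
  ∀ ⦃v w : V⦄, G.Adj v w → H.Adj (f v) (f w) ∨ f v = f w

/-- A loop based at `v₀`: a graph map from the infinite path `0, 1, 2, …` that starts at `v₀`
and is eventually constant equal to `v₀`. -/
def IsBasedLoop {V : Type*} (G : SimpleGraph V) (v₀ : V) (f : ℕ → V) : Prop :=
  IsGraphMap (hasse ℕ) G f ∧ f 0 = v₀ ∧ ∃ N : ℕ, ∀ m : ℕ, N ≤ m → f m = v₀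

/-- `G`-homotopy of loops based at `v₀`: a graph map from the grid (the cartesian product of the
infinite path and a finite path with vertices `0, …, k`) whose first row is `f`, whose last row
is `g`, and all of whose rows are loops based at `v₀`. -/
def GHomotopic {V : Type*} (G : SimpleGraph V) (v₀ : V) (f g : ℕ → V) : Prop :=
  ∃ (k : ℕ) (F : ℕ × Fin (k + 1) → V),
    IsGraphMap (hasse ℕ □ pathGraph (k + 1)) G F ∧
    (∀ m : ℕ, F (m, 0) = f m) ∧
    (∀ m : ℕ, F (m, Fin.last k) = g m) ∧
    ∀ j : Fin (k + 1), IsBasedLoop G v₀ (fun m => F (m, j))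

/-- The subgraph `C` is a cycle of length `k`. -/
def IsCycleOfLength {V : Type*} {G : SimpleGraph V} (k : ℕ) (C : G.Subgraph) : Prop :=
  ∃ (v : V) (p : G.Walk v v), p.IsCycle ∧ p.length = k ∧ p.toSubgraph = C

/-- A primitive 6-cycle: a 6-cycle that is not the concatenation of two 4-cycles (along a common
edge, which cancels). -/
def IsPrimitiveSixCycle {V : Type*} {G : SimpleGraph V} (C : G.Subgraph) : Prop :=
  IsCycleOfLength 6 C ∧
    ¬ ∃ D₁ D₂ : G.Subgraph, IsCycleOfLength 4 D₁ ∧ IsCycleOfLength 4 D₂ ∧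
      C.edgeSet = symmDiff D₁.edgeSet D₂.edgeSet

/-- `G`-homotopy of two cycles `C₁`, `C₂` relative to the base vertex `v₀`: there are walks
`P₁`, `P₂` from `v₀` to vertices of `C₁`, `C₂`, and closed walks `c₁`, `c₂` running once
around `C₁`, `C₂`, such that the based loops `P₁ c₁ P₁⁻¹` and `P₂ c₂ P₂⁻¹` are `G`-homotopic.
(`getVert` extends a finite walk to an infinite one by repeating its last vertex.) -/
def CyclesGHomotopic {V : Type*} {G : SimpleGraph V} (v₀ : V) (C₁ C₂ : G.Subgraph) : Prop :=
  ∃ (x₁ x₂ : V) (P₁ : G.Walk v₀ x₁) (c₁ : G.Walk x₁ x₁) (P₂ : G.Walk v₀ x₂) (c₂ : G.Walk x₂ x₂),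
    c₁.IsCycle ∧ c₁.toSubgraph = C₁ ∧ c₂.IsCycle ∧ c₂.toSubgraph = C₂ ∧
    GHomotopic G v₀ ((P₁.append c₁).append P₁.reverse).getVert
      ((P₂.append c₂).append P₂.reverse).getVert

/-- The `G`-homotopy class of `C` among the primitive 6-cycles of `G`. -/
def sixCycleClass {V : Type*} {G : SimpleGraph V} (v₀ : V) (C : G.Subgraph) : Set G.Subgraph :=
  {D | IsPrimitiveSixCycle D ∧ CyclesGHomotopic v₀ C D}

/-- The graph `Γ(Bₙ)`: the vertices are the permutations of an `n`-element set, and `σ`, `τ` are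
adjacent when `τ = σ s` for a simple transposition `s` of two consecutive points. -/
def gammaB (n : ℕ) : SimpleGraph (Equiv.Perm (Fin n)) where
  Adj σ τ := ∃ (k : ℕ) (h : k + 1 < n),
    τ = σ * Equiv.swap ⟨k, Nat.lt_of_succ_lt h⟩ ⟨k + 1, h⟩
  symm := ⟨by
    rintro σ τ ⟨k, h, rfl⟩
    exact ⟨k, h, by rw [mul_assoc, Equiv.swap_mul_self, mul_one]⟩⟩
  loopless := ⟨by
    rintro σ ⟨k, h, hk⟩
    have h1 := Equiv.swap_eq_one_iff.mp (left_eq_mul.mp hk)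
    simp at h1⟩

/-- The level of a permutation `σ` of `{1, …, n}` is `σ⁻¹(n)`. Since `Fin n` is `{0, …, n - 1}`,
both points and values are shifted by one. (For `n = 0` the value is irrelevant.) -/
def level {n : ℕ} (σ : Equiv.Perm (Fin n)) : ℕ :=
  if h : 0 < n then ((σ⁻¹ ⟨n - 1, Nat.sub_lt h Nat.one_pos⟩ : Fin n) : ℕ) + 1 else 0

/-- A vertical (primitive) 6-cycle at level `i`: two vertices in each of the three consecutive
levels `i - 1`, `i`, `i + 1`. -/
def IsVerticalAt {n : ℕ} (i : ℕ) (C : (gammaB n).Subgraph) : Prop :=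
  IsPrimitiveSixCycle C ∧
    ∀ j ∈ Finset.Icc (i - 1) (i + 1), {σ ∈ C.verts | level σ = j}.ncard = 2

/-- The `G`-homotopy classes of vertical 6-cycles at level `i` of `Γ(Bₙ)`. -/
def verticalClassesAt {n : ℕ} (σ₀ : Equiv.Perm (Fin n)) (i : ℕ) :
    Set (Set (gammaB n).Subgraph) :=
  {S | ∃ C : (gammaB n).Subgraph, IsVerticalAt i C ∧ S = sixCycleClass σ₀ C}

/-- The `G`-homotopy classes of all vertical 6-cycles of `Γ(Bₙ)`. -/
def verticalClasses {n : ℕ} (σ₀ : Equiv.Perm (Fin n)) : Set (Set (gammaB n).Subgraph) :=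
  {S | ∃ (i : ℕ) (C : (gammaB n).Subgraph), IsVerticalAt i C ∧ S = sixCycleClass σ₀ C}

end DiscreteHomotopy

/-! Write `c` for the largest value, count positions from 0 and let `s_k` exchange positions `k` and
`k + 1`. The vertical 6-cycles at level `j + 2` turn out to be exactly the cosets of `⟨s_j,
s_{j+1}⟩` that have a vertex `σ` with `c` in position `j + 2` (`IsVerticalAt.exists_eq_hexagon`,
`isVerticalAt_hexagon`). The class of such a hexagon is determined by, and determines, the pair `(U,
D)`: `U` is the set of values left of `c` in `σ`, and `D ⊆ U` the two values next to `c` on its left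
(`hexInvariant`).

Equal pairs give equal classes: two top vertices with the same `j` and the same pair differ by a
permutation of positions preserving the blocks `< j`, `{j, j+1}`, `{j+2}`, `> j+2`. Such a
permutation is a product of simple transpositions inside blocks (`perm_block_induction`). Here `s_j`
fixes the hexagon, while every other allowed `s_k` commutes with `s_j` and `s_{j+1}`, so it slides
the hexagon along edges to a parallel one, which is a `G`-homotopy (`CyclesGHomotopic.of_parallel`).

Distinct pairs give distinct classes: fix values `a ≠ b` and a set `L`, and count mod 2 the edges
that exchange `a` and `b` while exactly `L` lies to their left. This count vanishes around every
square (`isSquareCocycle_crossingWeight`), hence is a homotopy invariant of cycles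
(`CyclesGHomotopic.edgeWeight_eq`). When `c ∉ L`, and `a`, `b` differ from `c`, it is 1 on a hexagon
precisely when `D = {a, b}` and `U \ D = L` (`edgeWeight_hexagon`). The same count shows that
hexagons are primitive.

It remains to count pairs: choose `U` of size `i` avoiding `c`, then a 2-subset `D` of `U`. -/

namespace DiscreteHomotopy

open SimpleGraph

/-! ### Mod 2 square cocycles as homotopy invariants. -/

section Weight

variable {V : Type*} {G : SimpleGraph V}

/-- A mod 2 cochain on the edges of `G` which vanishes on degenerate edges and on the boundary of
every (possibly degenerate) square. -/
structure IsSquareCocycle (G : SimpleGraph V) (w : Sym2 V → ZMod 2) : Prop where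
  diag : ∀ v, w s(v, v) = 0
  square : ∀ p q r s, (G.Adj p q ∨ p = q) → (G.Adj q r ∨ q = r) → (G.Adj p s ∨ p = s) →
    (G.Adj s r ∨ s = r) → w s(p, q) + w s(q, r) = w s(p, s) + w s(s, r)

/-- Past its end the walk stands still, and degenerate edges weigh nothing, so any sufficiently long
range gives the same sum. -/
theorem sum_range_getVert {w : Sym2 V → ZMod 2} (hw : ∀ v, w s(v, v) = 0) {u v : V}
    (p : G.Walk u v) (N : ℕ) (hN : p.length ≤ N) :
    ∑ m ∈ Finset.range N, w s(p.getVert m, p.getVert (m + 1)) = (p.edges.map w).sum := by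
  induction p generalizing N with
  | nil => simp [hw]
  | cons h p ih =>
    obtain ⟨M, rfl⟩ : ∃ M, N = M + 1 := ⟨N - 1, by simp at hN; omega⟩
    rw [Finset.sum_range_succ']
    simp only [Walk.getVert_cons_succ, Walk.getVert_zero, Walk.edges_cons, List.map_cons,
      List.sum_cons]
    rw [ih M (by simpa using hN), add_comm]

/-- Gluing the `N` squares between two neighbouring rows: the weights of the inner vertical edges
cancel and only those at the two ends survive. -/
theorem IsSquareCocycle.sum_row_eq {w : Sym2 V → ZMod 2} (hw : IsSquareCocycle G w) {f g : ℕ → V}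
    (hf : ∀ m, G.Adj (f m) (f (m + 1)) ∨ f m = f (m + 1))
    (hg : ∀ m, G.Adj (g m) (g (m + 1)) ∨ g m = g (m + 1))
    (hfg : ∀ m, G.Adj (f m) (g m) ∨ f m = g m) (N : ℕ) :
    ∑ m ∈ Finset.range N, w s(f m, f (m + 1)) + w s(f N, g N) =
      w s(f 0, g 0) + ∑ m ∈ Finset.range N, w s(g m, g (m + 1)) := by
  induction N with
  | zero => simp
  | succ N ih =>
    have := hw.square (f N) (f (N + 1)) (g (N + 1)) (g N) (hf N) (hfg _) (hfg _) (hg N)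
    rw [Finset.sum_range_succ, Finset.sum_range_succ, add_assoc, this, ← add_assoc, ih, add_assoc]

theorem IsBasedLoop.step {v₀ : V} {f : ℕ → V} (hf : IsBasedLoop G v₀ f) (m : ℕ) :
    G.Adj (f m) (f (m + 1)) ∨ f m = f (m + 1) :=
  hf.1 (hasse_adj.2 (Or.inl (Nat.covBy_iff_add_one_eq.2 rfl)))

theorem isBasedLoop_of_step {v₀ : V} {f : ℕ → V}
    (h : ∀ m, G.Adj (f m) (f (m + 1)) ∨ f m = f (m + 1)) (h0 : f 0 = v₀)
    (hN : ∃ N : ℕ, ∀ m : ℕ, N ≤ m → f m = v₀) : IsBasedLoop G v₀ f := by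
  refine ⟨fun a b hab => ?_, h0, hN⟩
  rcases hasse_adj.1 hab with hab | hab
  · obtain rfl := Nat.covBy_iff_add_one_eq.1 hab
    exact h a
  · obtain rfl := Nat.covBy_iff_add_one_eq.1 hab
    exact (h b).imp (·.symm) (·.symm)

/-- Between consecutive rows both end edges are degenerate at the base point once `N` is past the
stabilisation of the two rows, so the total weight passes from row to row. -/
theorem GHomotopic.sum_eq {w : Sym2 V → ZMod 2} (hw : IsSquareCocycle G w) {v₀ : V} {f g : ℕ → V}
    (h : GHomotopic G v₀ f g) :
    ∃ N₀, ∀ N, N₀ ≤ N → ∑ m ∈ Finset.range N, w s(f m, f (m + 1)) =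
      ∑ m ∈ Finset.range N, w s(g m, g (m + 1)) := by
  obtain ⟨k, F, hF, h0, hk, hl⟩ := h
  have key : ∀ j : Fin (k + 1), ∃ N₀, ∀ N, N₀ ≤ N →
      ∑ m ∈ Finset.range N, w s(F (m, 0), F (m + 1, 0)) =
        ∑ m ∈ Finset.range N, w s(F (m, j), F (m + 1, j)) := by
    intro j
    induction j using Fin.induction with
    | zero => exact ⟨0, fun _ _ => rfl⟩
    | succ j ih =>
      obtain ⟨N₀, hN₀⟩ := ih
      obtain ⟨N₁, hN₁⟩ := (hl j.castSucc).2.2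
      obtain ⟨N₂, hN₂⟩ := (hl j.succ).2.2
      refine ⟨max N₀ (max N₁ N₂), fun N hN => ?_⟩
      rw [hN₀ N (by omega)]
      have := hw.sum_row_eq (f := fun m => F (m, j.castSucc)) (g := fun m => F (m, j.succ))
        (hl _).step (hl _).step
        (fun m => hF (boxProd_adj.2 (Or.inr ⟨pathGraph_adj.2 (Or.inl (by simp)), rfl⟩))) N
      have e1 := hN₁ N (by omega)
      have e2 := hN₂ N (by omega)
      have e3 := (hl j.castSucc).2.1
      have e4 := (hl j.succ).2.1
      simp only at this e1 e2 e3 e4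
      rwa [e1, e2, e3, e4, hw.diag, add_zero, zero_add] at this
  obtain ⟨N₀, hN₀⟩ := key (Fin.last k)
  exact ⟨N₀, fun N hN => by simpa only [h0, hk] using hN₀ N hN⟩

/-- The connecting path is traversed twice, which is invisible mod 2; this frees the weight of a
cycle from the choice of path and base vertex. -/
theorem sum_edges_conj {w : Sym2 V → ZMod 2} {u v : V} (p : G.Walk u v) (c : G.Walk v v) :
    ((((p.append c).append p.reverse).edges).map w).sum = (c.edges.map w).sum := by
  simp only [Walk.edges_append, Walk.edges_reverse, List.map_append, List.sum_append,
    List.map_reverse, List.sum_reverse]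
  rw [add_right_comm, CharTwo.add_self_eq_zero, zero_add]

variable [Finite V]

open Classical in
/-- The total weight of an edge set. -/
noncomputable def edgeWeight (w : Sym2 V → ZMod 2) (S : Set (Sym2 V)) : ZMod 2 :=
  ∑ e ∈ (Set.toFinite S).toFinset, w e

theorem edgeWeight_symmDiff (w : Sym2 V → ZMod 2) (S T : Set (Sym2 V)) :
    edgeWeight w (symmDiff S T) = edgeWeight w S + edgeWeight w T := by
  classical
  have := Fintype.ofFinite V
  have h (S : Set (Sym2 V)) : edgeWeight w S = ∑ e : Sym2 V, if e ∈ S then w e else 0 := by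
    rw [edgeWeight, ← Finset.sum_filter]
    congr 1
    ext; simp
  rw [h, h, h, ← Finset.sum_add_distrib]
  refine Finset.sum_congr rfl fun e _ => ?_
  by_cases hS : e ∈ S <;> by_cases hT : e ∈ T <;>
    simp [Set.mem_symmDiff, hS, hT, CharTwo.add_self_eq_zero]

theorem edgeWeight_toSubgraph (w : Sym2 V → ZMod 2) {u v : V} {p : G.Walk u v} (hp : p.IsTrail) :
    edgeWeight w p.toSubgraph.edgeSet = (p.edges.map w).sum := by
  classical
  rw [← List.sum_toFinset w hp.edges_nodup, edgeWeight]
  congr 1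
  ext e
  simp

theorem CyclesGHomotopic.edgeWeight_eq {w : Sym2 V → ZMod 2} (hw : IsSquareCocycle G w) {v₀ : V}
    {C D : G.Subgraph} (h : CyclesGHomotopic v₀ C D) :
    edgeWeight w C.edgeSet = edgeWeight w D.edgeSet := by
  obtain ⟨x₁, x₂, P₁, c₁, P₂, c₂, h₁, rfl, h₂, rfl, h⟩ := h
  obtain ⟨N₀, hN₀⟩ := h.sum_eq hw
  rw [edgeWeight_toSubgraph w h₁.isTrail, edgeWeight_toSubgraph w h₂.isTrail,
    ← sum_edges_conj P₁, ← sum_edges_conj P₂]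
  have := hN₀ (N₀ + ((P₁.append c₁).append P₁.reverse).length +
    ((P₂.append c₂).append P₂.reverse).length) (by omega)
  rwa [sum_range_getVert hw.diag _ _ (by omega), sum_range_getVert hw.diag _ _ (by omega)] at this

theorem IsSquareCocycle.edgeWeight_four_cycle {w : Sym2 V → ZMod 2} (hw : IsSquareCocycle G w)
    {C : G.Subgraph} (h : IsCycleOfLength 4 C) : edgeWeight w C.edgeSet = 0 := by
  obtain ⟨v, p, hp, hl, rfl⟩ := h
  rw [edgeWeight_toSubgraph w hp.isTrail, ← sum_range_getVert hw.diag p 4 hl.le]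
  have e : p.getVert 4 = p.getVert 0 := by
    rw [p.getVert_of_length_le hl.le, p.getVert_zero]
  have a (i : ℕ) (hi : i < 4) := p.adj_getVert_succ (i := i) (by omega)
  have a3 := a 3 (by norm_num)
  simp only [Finset.sum_range_succ, Finset.range_zero, Finset.sum_empty, zero_add, e] at a3 ⊢
  -- The 4-cycle is read as two paths of length 2 from vertex 0 to vertex 2, so its weight is twice
  -- that of one path.
  have := hw.square _ _ _ _ (.inl (a 0 (by norm_num))) (.inl (a 1 (by norm_num)))
    (.inl a3.symm) (.inl (a 2 (by norm_num)).symm)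
  simp only [Nat.reduceAdd] at this ⊢
  rw [this, Sym2.eq_swap (a := p.getVert 3) (b := p.getVert 0),
    Sym2.eq_swap (a := p.getVert 3) (b := p.getVert 2)]
  generalize w s(p.getVert 0, p.getVert 3) = x
  generalize w s(p.getVert 2, p.getVert 3) = y
  revert x y
  decide

/-- A 6-cycle on which some square cocycle does not vanish is primitive. -/
theorem IsSquareCocycle.isPrimitiveSixCycle {w : Sym2 V → ZMod 2} (hw : IsSquareCocycle G w)
    {C : G.Subgraph} (h : IsCycleOfLength 6 C) (hC : edgeWeight w C.edgeSet ≠ 0) :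
    IsPrimitiveSixCycle C := by
  refine ⟨h, ?_⟩
  rintro ⟨D₁, D₂, h₁, h₂, e⟩
  rw [e, edgeWeight_symmDiff, hw.edgeWeight_four_cycle h₁, hw.edgeWeight_four_cycle h₂] at hC
  exact hC (add_zero 0)

end Weight

/-! ### Constructing homotopies: sliding a cycle to a parallel one. -/

section Homotopy

variable {V : Type*} {G : SimpleGraph V}

theorem GHomotopic.refl {v₀ : V} {f : ℕ → V} (hf : IsBasedLoop G v₀ f) : GHomotopic G v₀ f f := by
  refine ⟨0, fun x => f x.1, ?_, fun _ => rfl, fun _ => rfl, fun _ => hf⟩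
  rintro ⟨a, i⟩ ⟨b, j⟩ h
  rcases boxProd_adj.1 h with h | h
  · exact hf.1 h.1
  · exact Or.inr (congrArg f h.2)

/-- Prepending a row to a homotopy. -/
theorem GHomotopic.cons {v₀ : V} {f g h : ℕ → V} (hf : IsBasedLoop G v₀ f)
    (hfg : ∀ m, G.Adj (f m) (g m) ∨ f m = g m) (H : GHomotopic G v₀ g h) :
    GHomotopic G v₀ f h := by
  obtain ⟨k, F, hF, h0, hk, hl⟩ := H
  refine ⟨k + 1, fun x => Fin.cases (motive := fun _ => V) (f x.1) (fun j => F (x.1, j)) x.2, ?_,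
    fun _ => rfl, fun m => hk m, fun j => ?_⟩
  · rintro ⟨a, i⟩ ⟨b, j⟩ hab
    rcases boxProd_adj.1 hab with ⟨h1, h2⟩ | ⟨h2, h1⟩
    · obtain rfl : i = j := h2
      cases i using Fin.cases with
      | zero => exact hf.1 h1
      | succ i => exact hF (boxProd_adj.2 (Or.inl ⟨h1, rfl⟩))
    · obtain rfl : a = b := h1
      replace h2 := pathGraph_adj.1 h2
      simp only at h2
      cases i using Fin.cases with
      | zero =>
        cases j using Fin.cases with
        | zero => simp at h2
        | succ j =>
          obtain rfl : j = 0 := by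
            ext
            simpa using h2
          change G.Adj (f a) (F (a, 0)) ∨ f a = F (a, 0)
          rw [h0]
          exact hfg a
      | succ i =>
        cases j using Fin.cases with
        | zero =>
          obtain rfl : i = 0 := by
            ext
            simpa using h2
          change G.Adj (F (a, 0)) (f a) ∨ F (a, 0) = f a
          rw [h0]
          exact (hfg a).imp (·.symm) (·.symm)
        | succ j =>
          exact hF (boxProd_adj.2 (Or.inr ⟨pathGraph_adj.2 (by simpa using h2), rfl⟩))
  · cases j using Fin.cases with
    | zero => exact hf
    | succ j => exact hl j

theorem isBasedLoop_getVert {v₀ : V} (p : G.Walk v₀ v₀) : IsBasedLoop G v₀ p.getVert := by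
  refine isBasedLoop_of_step (fun m => ?_) p.getVert_zero
    ⟨p.length, fun m hm => p.getVert_of_length_le hm⟩
  by_cases h : m < p.length
  · exact Or.inl (p.adj_getVert_succ h)
  · exact Or.inr (by rw [p.getVert_of_length_le (by omega), p.getVert_of_length_le (by omega)])

/-- The path `f` with a pause at time `t`. -/
def pause (t : ℕ) (f : ℕ → V) (m : ℕ) : V :=
  if m ≤ t then f m else f (m - 1)

theorem IsBasedLoop.pause {v₀ : V} {f : ℕ → V} (hf : IsBasedLoop G v₀ f) (t : ℕ) :
    IsBasedLoop G v₀ (pause t f) := by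
  refine isBasedLoop_of_step (fun m => ?_) ?_ ?_
  · unfold DiscreteHomotopy.pause
    rcases lt_trichotomy m t with h | h | h
    · rw [if_pos (by omega), if_pos (by omega)]
      exact hf.step m
    · rw [if_pos (by omega), if_neg (by omega)]
      exact Or.inr rfl
    · rw [if_neg (by omega), if_neg (by omega)]
      obtain ⟨k, rfl⟩ : ∃ k, m = k + 1 := ⟨m - 1, by omega⟩
      exact hf.step k
  · simpa [DiscreteHomotopy.pause] using hf.2.1
  · obtain ⟨N, hN⟩ := hf.2.2
    refine ⟨N + 1, fun m hm => ?_⟩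
    unfold DiscreteHomotopy.pause
    split_ifs
    · exact hN _ (by omega)
    · exact hN _ (by omega)

theorem IsBasedLoop.pause_adj {v₀ : V} {f : ℕ → V} (hf : IsBasedLoop G v₀ f) (t m : ℕ) :
    G.Adj (DiscreteHomotopy.pause t f m) (f m) ∨ DiscreteHomotopy.pause t f m = f m := by
  unfold DiscreteHomotopy.pause
  split_ifs with h
  · exact Or.inr rfl
  · obtain ⟨k, rfl⟩ : ∃ k, m = k + 1 := ⟨m - 1, by omega⟩
    exact hf.step k

/-- Conjugating by an edge `e : x ~ y` a closed walk that runs parallel to `c` along `e`. -/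
theorem GHomotopic.of_parallel {v₀ x y : V} (P : G.Walk v₀ x) (e : G.Adj x y) (c : G.Walk x x)
    (d : G.Walk y y) (hl : d.length = c.length)
    (hcd : ∀ m, G.Adj (d.getVert m) (c.getVert m)) {h : ℕ → V}
    (H : GHomotopic G v₀ ((P.append c).append P.reverse).getVert h) :
    GHomotopic G v₀ (((P.concat e).append d).append (P.concat e).reverse).getVert h := by
  have hb := isBasedLoop_getVert ((P.append c).append P.reverse)
  -- The loop around `c` pauses once on arriving at the cycle and once on leaving it. These are the
  -- moments when the other loop crosses `e` in either direction, so the two loops are then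
  -- synchronised and adjacent or equal at every time.
  have H1 := H.cons (hb.pause P.length) (hb.pause_adj _)
  have hb1 := hb.pause P.length
  have H2 := H1.cons (hb1.pause (P.length + c.length + 1)) (hb1.pause_adj _)
  refine H2.cons (isBasedLoop_getVert _) fun m => ?_
  have L : ∀ m, (((P.concat e).append d).append (P.concat e).reverse).getVert m =
      if m ≤ P.length then P.getVert m else
        if m ≤ P.length + 1 + c.length then d.getVert (m - (P.length + 1)) else
          P.reverse.getVert (m - (P.length + 2 + c.length)) := by
    intro m
    rw [Walk.reverse_concat, Walk.getVert_append, Walk.getVert_append, Walk.length_append,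
      Walk.length_concat, Walk.concat_eq_append, Walk.getVert_append, hl]
    rcases lt_trichotomy m P.length with h1 | h1 | h1
    · rw [if_pos (by omega), if_pos (by omega), if_pos (by omega), if_pos (by omega)]
    · subst h1
      rw [if_pos (by omega), if_pos (by omega), if_neg (by omega), if_pos (by omega)]
      simp
    · rw [if_neg (by omega : ¬ m ≤ _)]
      by_cases h2 : m < P.length + 1 + c.length
      · rw [if_pos h2, if_neg (by omega), if_pos (by omega)]
      · rw [if_neg h2]
        by_cases h3 : m = P.length + 1 + c.length
        · subst h3
          simp [← hl]
        · rw [if_neg (by omega)]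
          obtain ⟨k, rfl⟩ : ∃ k, m = P.length + 2 + c.length + k :=
            ⟨m - (P.length + 2 + c.length), by omega⟩
          rw [show P.length + 2 + c.length + k - (P.length + 1 + c.length) = k + 1 by omega,
            Walk.getVert_cons_succ]
          congr 1
          omega
  have R : ∀ m, ((P.append c).append P.reverse).getVert m =
      if m ≤ P.length then P.getVert m else
        if m ≤ P.length + c.length then c.getVert (m - P.length) else
          P.reverse.getVert (m - (P.length + c.length)) := by
    intro m
    rw [Walk.getVert_append, Walk.getVert_append, Walk.length_append]
    rcases lt_trichotomy m P.length with h1 | h1 | h1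
    · rw [if_pos (by omega), if_pos (by omega), if_pos (by omega)]
    · subst h1
      by_cases h : c.length = 0
      · simp [h]
      · rw [if_pos (by omega), if_neg (by omega), if_pos le_rfl]
        simp
    · rw [if_neg (by omega : ¬ m < P.length), if_neg (by omega : ¬ m ≤ P.length)]
      by_cases h2 : m < P.length + c.length
      · rw [if_pos h2, if_pos h2.le]
      · rw [if_neg h2]
        by_cases h3 : m = P.length + c.length
        · subst h3
          simp
        · rw [if_neg (by omega)]
  unfold DiscreteHomotopy.pause
  simp only [R, L]
  by_cases h1 : m ≤ P.length
  · rw [if_pos h1, if_pos (by omega), if_pos h1, if_pos h1]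
    exact Or.inr rfl
  by_cases h2 : m ≤ P.length + 1 + c.length
  · rw [if_neg h1, if_pos h2, if_pos (by omega), if_neg h1]
    left
    have := hcd (m - (P.length + 1))
    by_cases h3 : m = P.length + 1
    · subst h3
      simpa using this
    · rw [if_neg (by omega), if_pos (by omega)]
      rwa [show m - 1 - P.length = m - (P.length + 1) by omega]
  · rw [if_neg h1, if_neg h2, if_neg (by omega), if_neg (by omega)]
    right
    by_cases h3 : m = P.length + c.length + 2
    · subst h3
      rw [show P.length + c.length + 2 - 1 - 1 = P.length + c.length by omega]
      by_cases h4 : c.length = 0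
      · rw [if_pos (by omega), show P.length + c.length = P.length by omega]
        simp [h4]
      · rw [if_neg (by omega), if_pos le_rfl]
        simp [add_right_comm]
    · rw [if_neg (by omega), if_neg (by omega)]
      congr 1
      omega

theorem getVert_transfer {H : SimpleGraph V} {u v : V} (p : G.Walk u v)
    (hp : ∀ e ∈ p.edges, e ∈ H.edgeSet) (m : ℕ) : (p.transfer H hp).getVert m = p.getVert m := by
  induction p generalizing m with
  | nil => simp
  | cons h p ih =>
    cases m with
    | zero => simp
    | succ m => exact ih _ m

/-- Moving a cycle to a parallel one does not change its homotopy class. -/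
theorem CyclesGHomotopic.of_parallel {v₀ : V} {C C' D : G.Subgraph} {f : V → V}
    (hf : Function.Injective f) (hCf : ∀ v ∈ C.verts, G.Adj v (f v))
    (hv : C'.verts = f '' C.verts) (he : C'.edgeSet = Sym2.map f '' C.edgeSet)
    (h : CyclesGHomotopic v₀ C D) : CyclesGHomotopic v₀ C' D := by
  obtain ⟨x₁, x₂, P₁, c, P₂, c₂, h₁, rfl, h₂, rfl, h⟩ := h
  -- `f` need not be a graph map on all of `G`. The graph `H` keeps just the edges that `f` sends to
  -- edges; the cycle lies in `H`, and there `f` is a homomorphism.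
  let H : SimpleGraph V :=
    { Adj := fun v w => G.Adj v w ∧ G.Adj (f v) (f w)
      symm := ⟨fun _ _ h => ⟨h.1.symm, h.2.symm⟩⟩
      loopless := ⟨fun _ h => h.1.ne rfl⟩ }
  let φ : H →g G := ⟨f, fun h => h.2⟩
  have hc : ∀ e ∈ c.edges, e ∈ H.edgeSet := by
    intro e hec
    induction e with | h v w =>
    refine ⟨c.adj_of_mem_edges hec, ?_⟩
    rw [← G.mem_edgeSet]
    apply C'.edgeSet_subset
    rw [he]
    exact ⟨s(v, w), by simpa using hec, rfl⟩
  let d : G.Walk (f x₁) (f x₁) := (c.transfer H hc).map φ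
  have dv : ∀ m, d.getVert m = f (c.getVert m) := by
    intro m
    rw [Walk.getVert_map]
    change f _ = _
    rw [getVert_transfer]
  have hd : d.IsCycle := (h₁.transfer hc).map hf
  have hdC : d.toSubgraph = C' := by
    refine Subgraph.ext ?_ ?_
    · rw [hv]
      ext v
      simp [d, φ]
    · ext v w
      rw [← Subgraph.mem_edgeSet, ← Subgraph.mem_edgeSet, he, Walk.mem_edges_toSubgraph]
      simp [d, φ, Walk.edges_transfer]
  refine ⟨f x₁, x₂, P₁.concat (hCf x₁ (by simp)), d, P₂, c₂, hd, hdC, h₂, rfl, ?_⟩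
  refine GHomotopic.of_parallel P₁ _ c d (by simp [d]) (fun m => ?_) h
  rw [dv]
  exact (hCf _ (by simp)).symm

theorem CyclesGHomotopic.refl {v₀ : V} (hG : G.Connected) {C : G.Subgraph} {k : ℕ}
    (hC : IsCycleOfLength k C) : CyclesGHomotopic v₀ C C := by
  obtain ⟨v, c, hc, -, rfl⟩ := hC
  obtain ⟨P⟩ := hG.preconnected v₀ v
  exact ⟨v, v, P, c, P, c, hc, rfl, hc, rfl, GHomotopic.refl (isBasedLoop_getVert _)⟩

end Homotopy

/-! ### Simple transpositions and their relations. -/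

/-- The simple transposition `(k k+1)`. -/
def adjSwap {n : ℕ} (k : ℕ) (h : k + 1 < n) : Equiv.Perm (Fin n) :=
  Equiv.swap ⟨k, Nat.lt_of_succ_lt h⟩ ⟨k + 1, h⟩

section AdjSwap

variable {n : ℕ}

theorem gammaB_adj {σ τ : Equiv.Perm (Fin n)} :
    (gammaB n).Adj σ τ ↔ ∃ (k : ℕ) (h : k + 1 < n), τ = σ * adjSwap k h := Iff.rfl

theorem gammaB_adj_mul (σ : Equiv.Perm (Fin n)) (k : ℕ) (h : k + 1 < n) :
    (gammaB n).Adj σ (σ * adjSwap k h) := ⟨k, h, rfl⟩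

@[simp] theorem adjSwap_mul_self (k : ℕ) (h : k + 1 < n) : adjSwap k h * adjSwap k h = 1 :=
  Equiv.swap_mul_self _ _

@[simp] theorem mul_adjSwap_mul_self (σ : Equiv.Perm (Fin n)) (k : ℕ) (h : k + 1 < n) :
    σ * adjSwap k h * adjSwap k h = σ := by
  rw [mul_assoc, adjSwap_mul_self, mul_one]

@[simp] theorem adjSwap_inv (k : ℕ) (h : k + 1 < n) : (adjSwap k h)⁻¹ = adjSwap k h :=
  Equiv.swap_inv _ _

theorem adjSwap_val (k : ℕ) (h : k + 1 < n) (x : Fin n) :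
    (adjSwap k h x : ℕ) = if (x : ℕ) = k then k + 1 else if (x : ℕ) = k + 1 then k else x := by
  unfold adjSwap
  rw [Equiv.swap_apply_def]
  simp only [Fin.ext_iff]
  split_ifs <;> rfl

theorem mul_adjSwap_inv_val (σ : Equiv.Perm (Fin n)) (k : ℕ) (h : k + 1 < n) (x : Fin n) :
    ((σ * adjSwap k h)⁻¹ x : ℕ) = if (σ⁻¹ x : ℕ) = k then k + 1 else
      if (σ⁻¹ x : ℕ) = k + 1 then k else (σ⁻¹ x : ℕ) := by
  rw [mul_inv_rev, adjSwap_inv, Equiv.Perm.mul_apply, adjSwap_val]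

theorem adjSwap_comm (j k : ℕ) (hj : j + 1 < n) (hk : k + 1 < n) (h : j + 1 < k ∨ k + 1 < j) :
    adjSwap j hj * adjSwap k hk = adjSwap k hk * adjSwap j hj := by
  ext x
  simp only [Equiv.Perm.mul_apply, adjSwap_val]
  split_ifs <;> omega

theorem adjSwap_braid (j : ℕ) (hj : j + 2 < n) :
    adjSwap j (Nat.lt_of_succ_lt hj) * adjSwap (j + 1) hj * adjSwap j (Nat.lt_of_succ_lt hj) =
      adjSwap (j + 1) hj * adjSwap j (Nat.lt_of_succ_lt hj) * adjSwap (j + 1) hj := by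
  ext x
  simp only [Equiv.Perm.mul_apply, adjSwap_val]
  split_ifs <;> omega

end AdjSwap

/-! ### The cocycle counting exchanges of two values. -/

section CrossingWeight

variable {n : ℕ}

/-- The values placed to the left of both `a` and `b`. -/
def leftOf (a b : Fin n) (σ : Equiv.Perm (Fin n)) : Set (Fin n) :=
  {c | σ⁻¹ c < σ⁻¹ a ∧ σ⁻¹ c < σ⁻¹ b}

/-- `a` and `b` are placed side by side. -/
def Consecutive (a b : Fin n) (σ : Equiv.Perm (Fin n)) : Prop :=
  (σ⁻¹ a : ℕ) + 1 = σ⁻¹ b ∨ (σ⁻¹ b : ℕ) + 1 = σ⁻¹ a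

open Classical in
/-- The mod 2 cochain which counts the edges that exchange `a` and `b` while `L` is the set of
values to their left. -/
noncomputable def crossingWeight (a b : Fin n) (L : Set (Fin n)) :
    Sym2 (Equiv.Perm (Fin n)) → ZMod 2 :=
  Sym2.lift ⟨fun u v => if (u⁻¹ a < u⁻¹ b ↔ ¬ v⁻¹ a < v⁻¹ b) ∧ leftOf a b u = L ∧
    leftOf a b v = L then 1 else 0, fun u v =>
      if_congr ⟨fun h => ⟨by tauto, h.2.2, h.2.1⟩, fun h => ⟨by tauto, h.2.2, h.2.1⟩⟩ rfl rfl⟩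

open Classical in
theorem crossingWeight_mk (a b : Fin n) (L : Set (Fin n)) (u v : Equiv.Perm (Fin n)) :
    crossingWeight a b L s(u, v) = if (u⁻¹ a < u⁻¹ b ↔ ¬ v⁻¹ a < v⁻¹ b) ∧ leftOf a b u = L ∧
      leftOf a b v = L then 1 else 0 := rfl

theorem consecutive_of_exchange {a b : Fin n} (hab : a ≠ b) {u v : Equiv.Perm (Fin n)}
    (h : (gammaB n).Adj u v ∨ u = v) (ho : u⁻¹ a < u⁻¹ b ↔ ¬ v⁻¹ a < v⁻¹ b) :
    Consecutive a b u ∧ Consecutive a b v := by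
  have hu : (u⁻¹ a : ℕ) ≠ u⁻¹ b := fun e => hab (u⁻¹.injective (Fin.ext e))
  rcases h with ⟨k, hk, rfl⟩ | rfl
  · change u⁻¹ a < u⁻¹ b ↔ ¬ (u * adjSwap k hk)⁻¹ a < (u * adjSwap k hk)⁻¹ b at ho
    change _ ∧ Consecutive a b (u * adjSwap k hk)
    unfold Consecutive
    simp only [Fin.lt_def, mul_adjSwap_inv_val] at ho ⊢
    split_ifs at ho ⊢ <;> omega
  · tauto

/-- A simple transposition moving just one of two neighbours `a`, `b` would separate them. So it
either exchanges them or acts entirely on one side of the pair, and neither changes the set on the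
left. -/
theorem leftOf_eq_of_consecutive {a b : Fin n} {u v : Equiv.Perm (Fin n)}
    (h : (gammaB n).Adj u v ∨ u = v) (hu : Consecutive a b u) (hv : Consecutive a b v) :
    leftOf a b u = leftOf a b v := by
  rcases h with ⟨k, hk, rfl⟩ | rfl
  · change Consecutive a b (u * adjSwap k hk) at hv
    change _ = leftOf a b (u * adjSwap k hk)
    ext c
    unfold Consecutive at hu hv
    simp only [leftOf, Set.mem_ofPred_eq, Fin.lt_def, mul_adjSwap_inv_val] at hv ⊢
    split_ifs at hv ⊢ <;> omega
  · rfl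

theorem isSquareCocycle_crossingWeight {a b : Fin n} (hab : a ≠ b) (L : Set (Fin n)) :
    IsSquareCocycle (gammaB n) (crossingWeight a b L) := by
  classical
  refine ⟨fun v => ?_, fun p q r s hpq hqr hps hsr => ?_⟩
  · rw [crossingWeight_mk, if_neg]
    tauto
  · have E (u v) (h : (gammaB n).Adj u v ∨ u = v) := consecutive_of_exchange hab h
    have F (u v) (h : (gammaB n).Adj u v ∨ u = v) := leftOf_eq_of_consecutive (a := a) (b := b) h
    have e1 := E _ _ hpq
    have e2 := E _ _ hqr
    have e3 := E _ _ hps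
    have e4 := E _ _ hsr
    have f1 := F _ _ hpq
    have f2 := F _ _ hqr
    have f3 := F _ _ hps
    have f4 := F _ _ hsr
    have two : (1 + 1 : ZMod 2) = 0 := rfl
    simp only [crossingWeight_mk]
    -- The order of `a` and `b` changes along an even number of sides of the square. If it changes
    -- along two or more, `a` and `b` are side by side at every end of such a side, and the left
    -- sets agree along the sides joining them, so the contributions cancel.
    by_cases op : p⁻¹ a < p⁻¹ b <;> by_cases oq : q⁻¹ a < q⁻¹ b <;>
      by_cases or : r⁻¹ a < r⁻¹ b <;> by_cases os : s⁻¹ a < s⁻¹ b <;>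
      simp only [op, oq, or, os, not_true, not_false_eq_true, iff_true, iff_false, true_and,
        false_and, if_false, forall_const, IsEmpty.forall_iff, add_zero, zero_add] at e1 e2 e3 e4 ⊢ <;>
      grind

theorem exchange_iff {a b : Fin n} (hab : a ≠ b) (σ : Equiv.Perm (Fin n)) (k : ℕ) (h : k + 1 < n) :
    (σ⁻¹ a < σ⁻¹ b ↔ ¬ (σ * adjSwap k h)⁻¹ a < (σ * adjSwap k h)⁻¹ b) ↔
      ((σ⁻¹ a : ℕ) = k ∧ (σ⁻¹ b : ℕ) = k + 1) ∨ ((σ⁻¹ a : ℕ) = k + 1 ∧ (σ⁻¹ b : ℕ) = k) := by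
  have hu : (σ⁻¹ a : ℕ) ≠ σ⁻¹ b := fun e => hab (σ⁻¹.injective (Fin.ext e))
  simp only [Fin.lt_def, mul_adjSwap_inv_val]
  split_ifs <;> omega

theorem leftOf_mul_adjSwap_of_exchange {a b : Fin n} (hab : a ≠ b) (σ : Equiv.Perm (Fin n)) (k : ℕ)
    (h : k + 1 < n)
    (he : ((σ⁻¹ a : ℕ) = k ∧ (σ⁻¹ b : ℕ) = k + 1) ∨ ((σ⁻¹ a : ℕ) = k + 1 ∧ (σ⁻¹ b : ℕ) = k)) :
    leftOf a b (σ * adjSwap k h) = leftOf a b σ := by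
  obtain ⟨h1, h2⟩ := consecutive_of_exchange hab (Or.inl (gammaB_adj_mul σ k h))
    ((exchange_iff hab σ k h).2 he)
  exact (leftOf_eq_of_consecutive (.inl (gammaB_adj_mul σ k h)) h1 h2).symm

open Classical in
theorem crossingWeight_adjSwap {a b : Fin n} (hab : a ≠ b) (L : Set (Fin n))
    (σ : Equiv.Perm (Fin n)) (k : ℕ) (h : k + 1 < n) :
    crossingWeight a b L s(σ, σ * adjSwap k h) =
      if (((σ⁻¹ a : ℕ) = k ∧ (σ⁻¹ b : ℕ) = k + 1) ∨ ((σ⁻¹ a : ℕ) = k + 1 ∧ (σ⁻¹ b : ℕ) = k)) ∧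
        leftOf a b σ = L then 1 else 0 := by
  rw [crossingWeight_mk]
  refine if_congr ?_ rfl rfl
  rw [exchange_iff hab]
  refine ⟨fun H => ⟨H.1, H.2.1⟩, fun H => ⟨H.1, H.2, ?_⟩⟩
  rw [leftOf_mul_adjSwap_of_exchange hab σ k h H.1, H.2]

end CrossingWeight

/-! ### Hexagons, their translates and their weights. -/

section Hexagon

variable {n : ℕ}

theorem adjSwap_nodup (j : ℕ) (hj : j + 2 < n) :
    [1, adjSwap j (Nat.lt_of_succ_lt hj), adjSwap j (Nat.lt_of_succ_lt hj) * adjSwap (j + 1) hj,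
      adjSwap j (Nat.lt_of_succ_lt hj) * adjSwap (j + 1) hj * adjSwap j (Nat.lt_of_succ_lt hj),
      adjSwap (j + 1) hj * adjSwap j (Nat.lt_of_succ_lt hj), adjSwap (j + 1) hj].Nodup := by
  -- The six elements are told apart by their values at `j` and `j + 1`.
  refine List.Nodup.of_map (fun g : Equiv.Perm (Fin n) =>
    ((g ⟨j, by omega⟩ : ℕ), (g ⟨j + 1, by omega⟩ : ℕ))) ?_
  have h1 : ¬ j + 1 + 1 = j := by omega
  have h2 : ¬ j = j + 1 + 1 := by omega
  simp [adjSwap_val, h1, h2]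

theorem hexWalk_nodup (σ : Equiv.Perm (Fin n)) (j : ℕ) (hj : j + 2 < n) :
    [σ, σ * adjSwap j (Nat.lt_of_succ_lt hj),
      σ * adjSwap j (Nat.lt_of_succ_lt hj) * adjSwap (j + 1) hj,
      σ * adjSwap j (Nat.lt_of_succ_lt hj) * adjSwap (j + 1) hj * adjSwap j (Nat.lt_of_succ_lt hj),
      σ * adjSwap (j + 1) hj * adjSwap j (Nat.lt_of_succ_lt hj), σ * adjSwap (j + 1) hj].Nodup := by
  have := (adjSwap_nodup j hj).map (mul_right_injective σ)
  simpa only [List.map_cons, List.map_nil, mul_one, ← mul_assoc] using this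

theorem mul_adjSwap_braid (σ : Equiv.Perm (Fin n)) (j : ℕ) (hj : j + 2 < n) :
    σ * adjSwap j (Nat.lt_of_succ_lt hj) * adjSwap (j + 1) hj * adjSwap j (Nat.lt_of_succ_lt hj) =
      σ * adjSwap (j + 1) hj * adjSwap j (Nat.lt_of_succ_lt hj) * adjSwap (j + 1) hj := by
  rw [mul_assoc, mul_assoc, ← mul_assoc (adjSwap j _), adjSwap_braid j hj]
  simp only [mul_assoc]

/-- The closed walk around the coset of the parabolic subgroup generated by two consecutive simple
transpositions. -/
def hexWalk (σ : Equiv.Perm (Fin n)) (j : ℕ) (hj : j + 2 < n) : (gammaB n).Walk σ σ :=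
  .cons (gammaB_adj_mul σ j (Nat.lt_of_succ_lt hj)) <|
  .cons (gammaB_adj_mul _ (j + 1) hj) <|
  .cons (gammaB_adj_mul _ j (Nat.lt_of_succ_lt hj)) <|
  .cons (show (gammaB n).Adj _ (σ * adjSwap (j + 1) hj * adjSwap j (Nat.lt_of_succ_lt hj)) from
    mul_adjSwap_braid σ j hj ▸ (gammaB_adj_mul _ (j + 1) hj).symm) <|
  .cons (gammaB_adj_mul (σ * adjSwap (j + 1) hj) j (Nat.lt_of_succ_lt hj)).symm <|
  .cons (gammaB_adj_mul σ (j + 1) hj).symm .nil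

theorem isCycle_hexWalk (σ : Equiv.Perm (Fin n)) (j : ℕ) (hj : j + 2 < n) :
    (hexWalk σ j hj).IsCycle := by
  have := hexWalk_nodup σ j hj
  simp only [List.nodup_cons, List.mem_cons, List.not_mem_nil, or_false, not_or] at this
  rw [hexWalk, Walk.cons_isCycle_iff, Walk.isPath_def]
  simp only [Walk.support_cons, Walk.support_nil, Walk.edges_cons, Walk.edges_nil, List.nodup_cons,
    List.mem_cons, List.not_mem_nil, or_false, not_or, Sym2.eq_iff]
  grind

/-- The 6-cycle on the coset of `σ` of the subgroup generated by two consecutive simple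
transpositions. -/
def hexagon (σ : Equiv.Perm (Fin n)) (j : ℕ) (hj : j + 2 < n) : (gammaB n).Subgraph :=
  (hexWalk σ j hj).toSubgraph

theorem isCycleOfLength_hexagon (σ : Equiv.Perm (Fin n)) (j : ℕ) (hj : j + 2 < n) :
    IsCycleOfLength 6 (hexagon σ j hj) :=
  ⟨σ, hexWalk σ j hj, isCycle_hexWalk σ j hj, rfl, rfl⟩

theorem verts_hexagon (σ : Equiv.Perm (Fin n)) (j : ℕ) (hj : j + 2 < n) :
    (hexagon σ j hj).verts = {σ, σ * adjSwap j (Nat.lt_of_succ_lt hj),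
      σ * adjSwap j (Nat.lt_of_succ_lt hj) * adjSwap (j + 1) hj,
      σ * adjSwap j (Nat.lt_of_succ_lt hj) * adjSwap (j + 1) hj * adjSwap j (Nat.lt_of_succ_lt hj),
      σ * adjSwap (j + 1) hj * adjSwap j (Nat.lt_of_succ_lt hj), σ * adjSwap (j + 1) hj} := by
  ext v
  simp only [hexagon, Walk.mem_verts_toSubgraph, hexWalk, Walk.support_cons, Walk.support_nil,
    List.mem_cons, List.not_mem_nil, or_false, Set.mem_insert_iff, Set.mem_singleton_iff]
  tauto

/-- Every edge is reoriented to the shape `s(ρ, ρ * adjSwap k _)`, the form in which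
`crossingWeight_adjSwap` evaluates it. -/
theorem edges_hexWalk (σ : Equiv.Perm (Fin n)) (j : ℕ) (hj : j + 2 < n) :
    (hexWalk σ j hj).edges = [s(σ, σ * adjSwap j (Nat.lt_of_succ_lt hj)),
      s(σ * adjSwap j (Nat.lt_of_succ_lt hj),
        σ * adjSwap j (Nat.lt_of_succ_lt hj) * adjSwap (j + 1) hj),
      s(σ * adjSwap j (Nat.lt_of_succ_lt hj) * adjSwap (j + 1) hj, σ *
        adjSwap j (Nat.lt_of_succ_lt hj) * adjSwap (j + 1) hj * adjSwap j (Nat.lt_of_succ_lt hj)),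
      s(σ * adjSwap (j + 1) hj * adjSwap j (Nat.lt_of_succ_lt hj), σ *
        adjSwap (j + 1) hj * adjSwap j (Nat.lt_of_succ_lt hj) * adjSwap (j + 1) hj),
      s(σ * adjSwap (j + 1) hj, σ * adjSwap (j + 1) hj * adjSwap j (Nat.lt_of_succ_lt hj)),
      s(σ, σ * adjSwap (j + 1) hj)] := by
  simp only [hexWalk, Walk.edges_cons, Walk.edges_nil]
  rw [← mul_adjSwap_braid, Sym2.eq_swap (a := σ * adjSwap j (Nat.lt_of_succ_lt hj) *
    adjSwap (j + 1) hj * adjSwap j (Nat.lt_of_succ_lt hj)), Sym2.eq_swap (b := σ),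
    Sym2.eq_swap (b := σ * adjSwap (j + 1) hj)]

theorem mem_edgeSet_hexagon (σ : Equiv.Perm (Fin n)) (j : ℕ) (hj : j + 2 < n) (e) :
    e ∈ (hexagon σ j hj).edgeSet ↔ e ∈ (hexWalk σ j hj).edges :=
  Walk.mem_edges_toSubgraph _

theorem subgraph_ext_of_edgeSet {V : Type*} {G : SimpleGraph V} {C D : G.Subgraph}
    (hv : C.verts = D.verts) (he : C.edgeSet = D.edgeSet) : C = D := by
  refine Subgraph.ext hv ?_
  ext v w
  rw [← Subgraph.mem_edgeSet, he, Subgraph.mem_edgeSet]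

theorem hexagon_mul_adjSwap_self (σ : Equiv.Perm (Fin n)) (j : ℕ) (hj : j + 2 < n) :
    hexagon (σ * adjSwap j (Nat.lt_of_succ_lt hj)) j hj = hexagon σ j hj := by
  refine subgraph_ext_of_edgeSet ?_ ?_
  · ext v
    simp only [verts_hexagon, mul_adjSwap_mul_self, Set.mem_insert_iff, Set.mem_singleton_iff]
    tauto
  · ext e
    simp only [mem_edgeSet_hexagon, edges_hexWalk, mul_adjSwap_mul_self, List.mem_cons,
      List.not_mem_nil, or_false]
    have e1 := mul_adjSwap_braid σ j hj
    have e2 := congrArg (· * adjSwap (j + 1) hj) e1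
    simp only [mul_adjSwap_mul_self] at e2
    rw [e2, ← e1, Sym2.eq_swap (b := σ)]
    simp only [Sym2.eq_swap (a := σ * adjSwap (j + 1) hj * adjSwap j (Nat.lt_of_succ_lt hj)),
      Sym2.eq_swap (a := σ * adjSwap j (Nat.lt_of_succ_lt hj) * adjSwap (j + 1) hj)]
    tauto

theorem mul_adjSwap_comm (σ : Equiv.Perm (Fin n)) (j k : ℕ) (hj : j + 1 < n) (hk : k + 1 < n)
    (h : j + 1 < k ∨ k + 1 < j) :
    σ * adjSwap j hj * adjSwap k hk = σ * adjSwap k hk * adjSwap j hj := by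
  rw [mul_assoc, adjSwap_comm j k hj hk h, mul_assoc]

/-- Right multiplication by `s_k` moves each vertex along an edge, and since `s_k` commutes with
`s_j` and `s_{j+1}` it carries the hexagon onto a hexagon parallel to it. -/
theorem cyclesGHomotopic_hexagon_mul {σ₀ σ : Equiv.Perm (Fin n)} {j : ℕ} {hj : j + 2 < n} {k : ℕ}
    (hk : k + 1 < n) (h : k + 1 < j ∨ j + 2 < k) {D : (gammaB n).Subgraph}
    (H : CyclesGHomotopic σ₀ (hexagon σ j hj) D) :
    CyclesGHomotopic σ₀ (hexagon (σ * adjSwap k hk) j hj) D := by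
  have c1 (τ : Equiv.Perm (Fin n)) :=
    mul_adjSwap_comm τ k j hk (Nat.lt_of_succ_lt hj) (by omega)
  have c2 (τ : Equiv.Perm (Fin n)) := mul_adjSwap_comm τ k (j + 1) hk hj (by omega)
  refine H.of_parallel (mul_left_injective (adjSwap k hk)) (fun v _ => gammaB_adj_mul v k hk) ?_ ?_
  · simp only [verts_hexagon, c1, c2, Set.image_insert_eq, Set.image_singleton]
  · ext e
    simp only [mem_edgeSet_hexagon, edges_hexWalk, c1, c2, Set.mem_image, List.mem_cons,
      List.not_mem_nil, or_false, or_and_right, exists_or, exists_eq_left, Sym2.map_mk, eq_comm]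

theorem crossingWeight_adjSwap_eq_zero {a b c : Fin n} (hab : a ≠ b) (hca : c ≠ a) (hcb : c ≠ b)
    (L : Set (Fin n)) (σ : Equiv.Perm (Fin n)) (k : ℕ) (h : k + 1 < n)
    (hc : (σ⁻¹ c : ℕ) = k ∨ (σ⁻¹ c : ℕ) = k + 1) :
    crossingWeight a b L s(σ, σ * adjSwap k h) = 0 := by
  have h1 : (σ⁻¹ c : ℕ) ≠ σ⁻¹ a := fun e => hca (σ⁻¹.injective (Fin.ext e))
  have h2 : (σ⁻¹ c : ℕ) ≠ σ⁻¹ b := fun e => hcb (σ⁻¹.injective (Fin.ext e))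
  rw [crossingWeight_adjSwap hab, if_neg]
  omega

open Classical in
-- Only two opposite edges of the hexagon leave `c` in place, and only they can exchange `a` and
-- `b`. On one of them `c` is to the right of both positions exchanged; on the other it is to the
-- left, which `c ∉ L` excludes. So at most one edge is counted.
theorem edgeWeight_hexagon {a b c : Fin n} (hab : a ≠ b) (hca : c ≠ a) (hcb : c ≠ b)
    {L : Set (Fin n)} (hcL : c ∉ L) (σ : Equiv.Perm (Fin n)) (j : ℕ) (hj : j + 2 < n)
    (hc : (σ⁻¹ c : ℕ) = j + 2) :
    edgeWeight (crossingWeight a b L) (hexagon σ j hj).edgeSet =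
      if (((σ⁻¹ a : ℕ) = j ∧ (σ⁻¹ b : ℕ) = j + 1) ∨ ((σ⁻¹ a : ℕ) = j + 1 ∧ (σ⁻¹ b : ℕ) = j)) ∧
        leftOf a b σ = L then 1 else 0 := by
  rw [hexagon, edgeWeight_toSubgraph _ (isCycle_hexWalk σ j hj).isTrail, edges_hexWalk]
  simp only [List.map_cons, List.map_nil, List.sum_cons, List.sum_nil]
  rw [crossingWeight_adjSwap hab L σ j,
    crossingWeight_adjSwap_eq_zero hab hca hcb L _ (j + 1) hj (by grind [mul_adjSwap_inv_val]),
    crossingWeight_adjSwap_eq_zero hab hca hcb L _ j _ (by grind [mul_adjSwap_inv_val]),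
    crossingWeight_adjSwap_eq_zero hab hca hcb L (σ * adjSwap (j + 1) hj) j _
      (by grind [mul_adjSwap_inv_val]),
    crossingWeight_adjSwap_eq_zero hab hca hcb L σ (j + 1) hj (Or.inr hc),
    crossingWeight_adjSwap hab L _ (j + 1), if_neg (c := _ ∧ leftOf a b (_ * _) = L)]
  · simp
  · rintro ⟨h1, rfl⟩
    apply hcL
    set τ := σ * adjSwap (j + 1) hj * adjSwap j (Nat.lt_of_succ_lt hj) with hτ
    have : (τ⁻¹ c : ℕ) = j := by
      grind [mul_adjSwap_inv_val]
    simp only [leftOf, Set.mem_ofPred_eq, Fin.lt_def]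
    omega

end Hexagon

/-! ### Classification of the vertical 6-cycles. -/

theorem or_six_reverse {A B C D E F : Prop} :
    A ∨ B ∨ C ∨ D ∨ E ∨ F ↔ F ∨ E ∨ D ∨ C ∨ B ∨ A := by
  constructor <;> (rintro (h | h | h | h | h | h) <;> simp only [h, true_or, or_true])

theorem or_iff_symmDiff {A₁ A₂ A₃ B₁ B₂ B₃ : Prop} (h : B₁ ∨ B₂ ∨ B₃ → ¬ A₁ ∧ ¬ A₂ ∧ ¬ A₃) :
    A₁ ∨ A₂ ∨ B₁ ∨ B₂ ∨ B₃ ∨ A₃ ↔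
      (A₁ ∨ A₂ ∨ A₃) ∧ ¬ (B₁ ∨ B₂ ∨ B₃) ∨ (B₁ ∨ B₂ ∨ B₃) ∧ ¬ (A₁ ∨ A₂ ∨ A₃) := by
  by_cases hB : B₁ ∨ B₂ ∨ B₃
  · obtain ⟨h₁, h₂, h₃⟩ := h hB
    simp only [h₁, h₂, h₃, hB, false_or, or_false, not_false_eq_true, not_true, and_true, and_false]
  · simp only [not_or] at hB
    simp only [hB, false_or, or_false, not_false_eq_true, and_true, false_and]

set_option linter.unusedSimpArgs false in
-- The `xᵢ` are the positions of the largest value around a cycle whose omitted initial vertex has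
-- position `j + 2`; hence the last count is 1 instead of 2. Up to the direction of travel only one
-- pattern survives.
theorem level_pattern {j x₁ x₂ x₃ x₄ x₅ : ℕ}
    (c₁ : (if x₁ = j then 1 else 0) + (if x₂ = j then 1 else 0) + (if x₃ = j then 1 else 0) +
      (if x₄ = j then 1 else 0) + (if x₅ = j then 1 else 0) = 2)
    (c₂ : (if x₁ = j + 1 then 1 else 0) + (if x₂ = j + 1 then 1 else 0) +
      (if x₃ = j + 1 then 1 else 0) + (if x₄ = j + 1 then 1 else 0) +
      (if x₅ = j + 1 then 1 else 0) = 2)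
    (c₃ : (if x₁ = j + 2 then 1 else 0) + (if x₂ = j + 2 then 1 else 0) +
      (if x₃ = j + 2 then 1 else 0) + (if x₄ = j + 2 then 1 else 0) +
      (if x₅ = j + 2 then 1 else 0) = 1)
    (b₁ : j + 1 ≤ x₁) (b₂ : j + 1 ≤ x₅) (b₃ : x₁ ≤ x₂ + 1) (b₄ : x₅ ≤ x₄ + 1)
    (hne : ¬ (x₁ = j + 1 ∧ x₅ = j + 1)) :
    (x₁ = j + 2 ∧ x₂ = j + 1 ∧ x₃ = j ∧ x₄ = j ∧ x₅ = j + 1) ∨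
      (x₅ = j + 2 ∧ x₄ = j + 1 ∧ x₃ = j ∧ x₂ = j ∧ x₁ = j + 1) := by
  have key (x : ℕ) : (if x = j then 1 else 0) + (if x = j + 1 then 1 else 0) +
      (if x = j + 2 then 1 else 0) ≤ 1 ∧ ((x = j ∨ x = j + 1 ∨ x = j + 2) ∨
      (if x = j then 1 else 0) + (if x = j + 1 then 1 else 0) + (if x = j + 2 then 1 else 0) = 0) := by
    split_ifs <;> omega
  have k₁ := key x₁
  have k₂ := key x₂
  have k₃ := key x₃
  have k₄ := key x₄
  have k₅ := key x₅
  have r₁ := k₁.2.resolve_right (by omega)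
  have r₂ := k₂.2.resolve_right (by omega)
  have r₃ := k₃.2.resolve_right (by omega)
  have r₄ := k₄.2.resolve_right (by omega)
  have r₅ := k₅.2.resolve_right (by omega)
  clear key k₁ k₂ k₃ k₄ k₅
  have e₁ : ¬ j = j + 1 := by omega
  have e₂ : ¬ j = j + 2 := by omega
  rcases r₁ with rfl | rfl | rfl
  · omega
  · rcases r₅ with rfl | rfl | rfl
    · omega
    · omega
    · rcases r₄ with rfl | rfl | rfl <;> rcases r₃ with rfl | rfl | rfl <;>
        rcases r₂ with rfl | rfl | rfl <;> simp [e₁, e₂] at c₁ c₂ c₃ ⊢ <;> omega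
  · rcases r₅ with rfl | rfl | rfl
    · omega
    · rcases r₂ with rfl | rfl | rfl <;> rcases r₃ with rfl | rfl | rfl <;>
        rcases r₄ with rfl | rfl | rfl <;> simp [e₁, e₂] at c₁ c₂ c₃ ⊢ <;> omega
    · simp [e₁, e₂] at c₃

section FourCycle

variable {V : Type*} {G : SimpleGraph V}

theorem exists_four_cycle {a b c d : V} (hn : [a, b, c, d].Nodup) (hab : G.Adj a b)
    (hbc : G.Adj b c) (hcd : G.Adj c d) (hda : G.Adj d a) :
    ∃ D : G.Subgraph, IsCycleOfLength 4 D ∧ D.edgeSet = {s(a, b), s(b, c), s(c, d), s(d, a)} := by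
  let p : G.Walk a a := .cons hab (.cons hbc (.cons hcd (.cons hda .nil)))
  refine ⟨p.toSubgraph, ⟨a, p, ?_, rfl, rfl⟩, ?_⟩
  · simp only [List.nodup_cons, List.mem_cons, List.not_mem_nil, or_false, not_or] at hn
    rw [Walk.cons_isCycle_iff, Walk.isPath_def]
    simp only [Walk.support_cons, Walk.support_nil, Walk.edges_cons, Walk.edges_nil,
      List.nodup_cons, List.mem_cons, List.not_mem_nil, or_false, not_or, Sym2.eq_iff]
    grind
  · ext e
    simp only [p, Walk.mem_edges_toSubgraph, Walk.edges_cons, Walk.edges_nil, List.mem_cons,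
      List.not_mem_nil, or_false, Set.mem_insert_iff, Set.mem_singleton_iff]

theorem exists_vertices_of_length_six {v : V} {p : G.Walk v v} (hl : p.length = 6) :
    ∃ v₁ v₂ v₃ v₄ v₅ : V, G.Adj v v₁ ∧ G.Adj v₁ v₂ ∧ G.Adj v₂ v₃ ∧ G.Adj v₃ v₄ ∧ G.Adj v₄ v₅ ∧
      G.Adj v₅ v ∧ p.support = [v, v₁, v₂, v₃, v₄, v₅, v] ∧
      p.edges = [s(v, v₁), s(v₁, v₂), s(v₂, v₃), s(v₃, v₄), s(v₄, v₅), s(v₅, v)] := by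
  have H : ∀ {w : V} (q : G.Walk w v), q.length = 1 → G.Adj w v ∧ q.support = [w, v] ∧
      q.edges = [s(w, v)] := by
    intro w q hq
    cases q with
    | nil => simp at hq
    | cons h q =>
      cases q with
      | nil => exact ⟨h, rfl, rfl⟩
      | cons _ _ => simp at hq
  obtain _ | ⟨h₁, p⟩ := p
  · simp at hl
  obtain _ | ⟨h₂, p⟩ := p
  · simp at hl
  obtain _ | ⟨h₃, p⟩ := p
  · simp at hl
  obtain _ | ⟨h₄, p⟩ := p
  · simp at hl
  obtain _ | ⟨h₅, p⟩ := p
  · simp at hl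
  obtain ⟨h₆, hs, he⟩ := H p (by simpa using hl)
  exact ⟨_, _, _, _, _, h₁, h₂, h₃, h₄, h₅, h₆, by simp [hs], by simp [he]⟩

end FourCycle

section Level

variable {n : ℕ}

theorem level_eq {c : Fin n} (hc : (c : ℕ) + 1 = n) (σ : Equiv.Perm (Fin n)) :
    level σ = (σ⁻¹ c : ℕ) + 1 := by
  have (h : n - 1 < n) : (⟨n - 1, h⟩ : Fin n) = c := Fin.ext (by simp; omega)
  rw [level, dif_pos (by omega : 0 < n), this]

theorem adjSwap_left (k : ℕ) (h : k + 1 < n) :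
    adjSwap k h ⟨k, Nat.lt_of_succ_lt h⟩ = ⟨k + 1, h⟩ :=
  Equiv.swap_apply_left _ _

theorem adjSwap_of_ne {k : ℕ} (h : k + 1 < n) {x : Fin n} (h₁ : (x : ℕ) ≠ k)
    (h₂ : (x : ℕ) ≠ k + 1) : adjSwap k h x = x :=
  Equiv.swap_apply_of_ne_of_ne (fun e => h₁ (congrArg Fin.val e)) (fun e => h₂ (congrArg Fin.val e))

/-- An edge that changes the level has a forced label; only level-preserving edges leave a choice.
-/
theorem eq_mul_adjSwap_of_lt {c : Fin n} {σ τ : Equiv.Perm (Fin n)} (h : (gammaB n).Adj σ τ) {k : ℕ}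
    (hk : k + 1 < n) (hσ : (σ⁻¹ c : ℕ) = k + 1) (hτ : (τ⁻¹ c : ℕ) = k) :
    τ = σ * adjSwap k hk := by
  obtain ⟨l, hl, rfl⟩ := gammaB_adj.1 h
  rw [mul_adjSwap_inv_val] at hτ
  obtain rfl : k = l := by split_ifs at hτ <;> omega
  rfl

theorem level_le_of_adj {c : Fin n} {σ τ : Equiv.Perm (Fin n)} (h : (gammaB n).Adj σ τ) :
    (τ⁻¹ c : ℕ) ≤ (σ⁻¹ c : ℕ) + 1 := by
  obtain ⟨l, hl, rfl⟩ := gammaB_adj.1 h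
  rw [mul_adjSwap_inv_val]
  split_ifs <;> omega

theorem isPrimitiveSixCycle_hexagon {c : Fin n} (σ : Equiv.Perm (Fin n)) (j : ℕ) (hj : j + 2 < n)
    (hc : (σ⁻¹ c : ℕ) = j + 2) : IsPrimitiveSixCycle (hexagon σ j hj) := by
  obtain ⟨a, ha⟩ : ∃ a, (σ⁻¹ a : ℕ) = j := ⟨σ ⟨j, by omega⟩, by simp⟩
  obtain ⟨b, hb⟩ : ∃ b, (σ⁻¹ b : ℕ) = j + 1 := ⟨σ ⟨j + 1, by omega⟩, by simp⟩
  have hab : a ≠ b := by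
    rintro h
    rw [h] at ha
    omega
  have hca : c ≠ a := by
    rintro rfl
    omega
  have hcb : c ≠ b := by
    rintro rfl
    omega
  have hcL : c ∉ leftOf a b σ := by
    simp only [leftOf, Set.mem_ofPred_eq, Fin.lt_def]
    omega
  refine (isSquareCocycle_crossingWeight hab (leftOf a b σ)).isPrimitiveSixCycle
    (isCycleOfLength_hexagon σ j hj) ?_
  rw [edgeWeight_hexagon hab hca hcb hcL σ j hj hc, if_pos ⟨Or.inl ⟨ha, hb⟩, rfl⟩]
  exact one_ne_zero

theorem isVerticalAt_hexagon {c : Fin n} (hcn : (c : ℕ) + 1 = n) (σ : Equiv.Perm (Fin n)) (j : ℕ)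
    (hj : j + 2 < n) (hc : (σ⁻¹ c : ℕ) = j + 2) : IsVerticalAt (j + 2) (hexagon σ j hj) := by
  refine ⟨isPrimitiveSixCycle_hexagon σ j hj hc, fun l hl => ?_⟩
  have hn := hexWalk_nodup σ j hj
  have l0 : level σ = j + 3 := by rw [level_eq hcn]; omega
  have l1 : level (σ * adjSwap j (Nat.lt_of_succ_lt hj)) = j + 3 := by
    rw [level_eq hcn]; grind [mul_adjSwap_inv_val]
  have l2 : level (σ * adjSwap j (Nat.lt_of_succ_lt hj) * adjSwap (j + 1) hj) = j + 2 := by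
    rw [level_eq hcn]; grind [mul_adjSwap_inv_val]
  have l3 : level (σ * adjSwap j (Nat.lt_of_succ_lt hj) * adjSwap (j + 1) hj *
      adjSwap j (Nat.lt_of_succ_lt hj)) = j + 1 := by
    rw [level_eq hcn]; grind [mul_adjSwap_inv_val]
  have l5 : level (σ * adjSwap (j + 1) hj) = j + 2 := by
    rw [level_eq hcn]; grind [mul_adjSwap_inv_val]
  have l4 : level (σ * adjSwap (j + 1) hj * adjSwap j (Nat.lt_of_succ_lt hj)) = j + 1 := by
    rw [level_eq hcn]; grind [mul_adjSwap_inv_val]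
  rw [verts_hexagon]
  generalize σ * adjSwap j (Nat.lt_of_succ_lt hj) * adjSwap (j + 1) hj *
    adjSwap j (Nat.lt_of_succ_lt hj) = v3 at *
  generalize σ * adjSwap j (Nat.lt_of_succ_lt hj) * adjSwap (j + 1) hj = v2 at *
  generalize σ * adjSwap j (Nat.lt_of_succ_lt hj) = v1 at *
  generalize σ * adjSwap (j + 1) hj * adjSwap j (Nat.lt_of_succ_lt hj) = v4 at *
  generalize σ * adjSwap (j + 1) hj = v5 at *
  simp only [List.nodup_cons, List.mem_cons, List.not_mem_nil, or_false, not_or] at hn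
  rw [Finset.mem_Icc] at hl
  rw [Set.ncard_eq_two]
  obtain rfl | rfl | rfl : l = j + 1 ∨ l = j + 2 ∨ l = j + 3 := by omega
  · refine ⟨v3, v4, by tauto, ?_⟩
    ext v
    simp only [Set.mem_ofPred_eq, Set.mem_insert_iff, Set.mem_singleton_iff]
    grind
  · refine ⟨v2, v5, by tauto, ?_⟩
    ext v
    simp only [Set.mem_ofPred_eq, Set.mem_insert_iff, Set.mem_singleton_iff]
    grind
  · refine ⟨σ, v1, by tauto, ?_⟩
    ext v
    simp only [Set.mem_ofPred_eq, Set.mem_insert_iff, Set.mem_singleton_iff]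
    grind

/-- A primitive 6-cycle with the level pattern `j+2, j+2, j+1, j, j, j+1` is a hexagon. -/
theorem eq_hexagon_of_levels {c : Fin n} {C : (gammaB n).Subgraph} (hC : IsPrimitiveSixCycle C)
    {v₀ v₁ v₂ v₃ v₄ v₅ : Equiv.Perm (Fin n)} (hn : [v₀, v₁, v₂, v₃, v₄, v₅].Nodup)
    (h₁ : (gammaB n).Adj v₀ v₁) (h₂ : (gammaB n).Adj v₁ v₂) (h₃ : (gammaB n).Adj v₂ v₃)
    (h₄ : (gammaB n).Adj v₃ v₄) (h₅ : (gammaB n).Adj v₄ v₅) (h₀ : (gammaB n).Adj v₅ v₀)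
    (hv : C.verts = {v₀, v₁, v₂, v₃, v₄, v₅})
    (he : C.edgeSet = {s(v₀, v₁), s(v₁, v₂), s(v₂, v₃), s(v₃, v₄), s(v₄, v₅), s(v₅, v₀)})
    (j : ℕ) (hj : j + 2 < n) (l₀ : (v₀⁻¹ c : ℕ) = j + 2) (l₁ : (v₁⁻¹ c : ℕ) = j + 2)
    (l₂ : (v₂⁻¹ c : ℕ) = j + 1) (l₃ : (v₃⁻¹ c : ℕ) = j) (l₄ : (v₄⁻¹ c : ℕ) = j)
    (l₅ : (v₅⁻¹ c : ℕ) = j + 1) : C = hexagon v₀ j hj := by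
  obtain ⟨k, hk, e₁⟩ := gammaB_adj.1 h₁
  obtain ⟨l, hl, e⟩ := gammaB_adj.1 h₄
  have e₂ := eq_mul_adjSwap_of_lt h₂ hj l₁ l₂
  have e₃ := eq_mul_adjSwap_of_lt h₃ (Nat.lt_of_succ_lt hj) l₂ l₃
  have e₅ := eq_mul_adjSwap_of_lt h₀.symm hj l₀ l₅
  have e₄ := eq_mul_adjSwap_of_lt h₅.symm (Nat.lt_of_succ_lt hj) l₅ l₄
  have hk' : k ≠ j + 1 ∧ k ≠ j + 2 := by
    rw [e₁, mul_adjSwap_inv_val, l₀] at l₁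
    split_ifs at l₁ <;> omega
  by_cases hkj : k = j
  · subst hkj
    subst e₅ e₄ e₁ e₂ e₃
    refine subgraph_ext_of_edgeSet ?_ ?_
    · rw [hv, verts_hexagon]
    · rw [he]
      ext x
      rw [mem_edgeSet_hexagon, hexWalk]
      simp
  exfalso
  -- The label `k` of the top edge is not `j`, `j + 1` or `j + 2`. Either `k = j - 1`, which
  -- prevents the cycle from closing up, or `s_k` commutes with `s_{j+1}`, which gives a chord.
  by_cases hkj' : k + 1 = j
  · have key : adjSwap l hl = adjSwap j (Nat.lt_of_succ_lt hj) * (adjSwap (j + 1) hj *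
        (adjSwap k hk * (adjSwap (j + 1) hj * adjSwap j (Nat.lt_of_succ_lt hj)))) := by
      rw [e₄, e₅, e₃, e₂, e₁] at e
      simp only [mul_assoc] at e
      have e' := mul_left_cancel e
      have e2 := congrArg (fun x => adjSwap j (Nat.lt_of_succ_lt hj) * (adjSwap (j + 1) hj *
        (adjSwap k hk * x))) e'
      simp only [← mul_assoc, adjSwap_mul_self, one_mul] at e2
      simpa only [mul_assoc] using e2.symm
    -- The right-hand side sends `k` to `k + 2`, which no simple transposition does.
    have := congrArg (fun g : Equiv.Perm (Fin n) => (g ⟨k, by omega⟩ : ℕ)) key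
    subst hkj'
    simp only [Equiv.Perm.mul_apply] at this
    rw [adjSwap_of_ne (x := ⟨k, _⟩) (k := k + 1), adjSwap_of_ne (x := ⟨k, _⟩) (k := k + 1 + 1),
      adjSwap_left, adjSwap_of_ne (k := k + 1 + 1), adjSwap_left, adjSwap_val] at this
    · simp only at this
      split_ifs at this <;> omega
    all_goals simp only; omega
  · have comm := mul_adjSwap_comm v₀ k (j + 1) hk hj (by omega)
    rw [← e₁, ← e₅, ← e₂] at comm
    -- This chord cuts the 6-cycle into two 4-cycles, contradicting primitivity.
    have h₂₅ : (gammaB n).Adj v₅ v₂ := gammaB_adj.2 ⟨k, hk, comm⟩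
    simp only [List.nodup_cons, List.mem_cons, List.not_mem_nil, or_false, not_or] at hn
    obtain ⟨D₁, hD₁, eD₁⟩ := exists_four_cycle (a := v₀) (b := v₁) (c := v₂) (d := v₅)
      (by simp only [List.nodup_cons, List.mem_cons, List.not_mem_nil, or_false, not_or]; tauto)
      h₁ h₂ h₂₅.symm h₀
    obtain ⟨D₂, hD₂, eD₂⟩ := exists_four_cycle (a := v₂) (b := v₃) (c := v₄) (d := v₅)
      (by simp only [List.nodup_cons, List.mem_cons, List.not_mem_nil, or_false, not_or]; tauto)
      h₃ h₄ h₅ h₂₅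
    refine hC.2 ⟨D₁, D₂, hD₁, hD₂, ?_⟩
    rw [he, eD₁, eD₂]
    ext x
    simp only [Set.mem_symmDiff, Set.mem_insert_iff, Set.mem_singleton_iff]
    have n1 : s(v₂, v₅) ≠ s(v₀, v₁) := by rw [Ne, Sym2.eq_iff]; grind
    have n2 : s(v₂, v₅) ≠ s(v₁, v₂) := by rw [Ne, Sym2.eq_iff]; grind
    have n3 : s(v₂, v₅) ≠ s(v₅, v₀) := by rw [Ne, Sym2.eq_iff]; grind
    have n4 : s(v₂, v₅) ≠ s(v₂, v₃) := by rw [Ne, Sym2.eq_iff]; grind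
    have n5 : s(v₂, v₅) ≠ s(v₃, v₄) := by rw [Ne, Sym2.eq_iff]; grind
    have n6 : s(v₂, v₅) ≠ s(v₄, v₅) := by rw [Ne, Sym2.eq_iff]; grind
    have m1 : ∀ y, y = s(v₂, v₃) ∨ y = s(v₃, v₄) ∨ y = s(v₄, v₅) →
        y ≠ s(v₀, v₁) ∧ y ≠ s(v₁, v₂) ∧ y ≠ s(v₅, v₀) := by
      rintro y (rfl | rfl | rfl) <;> refine ⟨?_, ?_, ?_⟩ <;> rw [Ne, Sym2.eq_iff] <;> grind
    rw [Sym2.eq_swap (a := v₅) (b := v₂)]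
    have := m1 x
    by_cases hx : x = s(v₂, v₅)
    · subst hx
      simp [n1, n2, n3, n4, n5, n6]
    · simp only [hx, false_or, or_false]
      exact or_iff_symmDiff this

theorem countP_level {C : (gammaB n).Subgraph} {vs : List (Equiv.Perm (Fin n))} (hn : vs.Nodup)
    (hv : ∀ v, v ∈ C.verts ↔ v ∈ vs) (l : ℕ) :
    {σ ∈ C.verts | level σ = l}.ncard = vs.countP (fun v => level v = l) := by
  have : {σ ∈ C.verts | level σ = l} = ((vs.filter (fun v => level v = l)).toFinset : Set _) := by
    ext v
    simp [hv]
  rw [this, Set.ncard_coe_finset, List.toFinset_card_of_nodup (hn.filter _), List.countP_eq_length_filter]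

/-- Every vertical 6-cycle is a hexagon. -/
theorem IsVerticalAt.exists_eq_hexagon {c : Fin n} (hcn : (c : ℕ) + 1 = n) {i : ℕ}
    {C : (gammaB n).Subgraph} (h : IsVerticalAt i C) :
    ∃ (j : ℕ) (hj : j + 2 < n) (σ : Equiv.Perm (Fin n)), i = j + 2 ∧ (σ⁻¹ c : ℕ) = j + 2 ∧
      C = hexagon σ j hj := by
  obtain ⟨hC, hlev⟩ := h
  have pos (l) (hl : l ∈ Finset.Icc (i - 1) (i + 1)) : ∃ σ ∈ C.verts, level σ = l := by
    have := hlev l hl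
    have h2 : {σ ∈ C.verts | level σ = l}.Nonempty := by
      rw [← Set.ncard_pos]
      omega
    exact h2
  -- Levels start at 1, so the presence of a vertex at level `i - 1` forces `i ≥ 2`, even though the
  -- subtraction is truncated.
  obtain ⟨j, rfl⟩ : ∃ j, i = j + 2 := by
    obtain ⟨σ, -, h⟩ := pos (i - 1) (by simp; omega)
    rw [level_eq hcn] at h
    exact ⟨i - 2, by omega⟩
  obtain ⟨u, hu, hlu⟩ := pos (j + 3) (by simp)
  rw [level_eq hcn] at hlu
  have hj : j + 2 < n := by
    have := (u⁻¹ c).isLt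
    omega
  obtain ⟨v, p, hp, hl, rfl⟩ := hC.1
  -- The cycle is rotated to start at the top-level vertex `u`.
  obtain ⟨v₁, v₂, v₃, v₄, v₅, h₁, h₂, h₃, h₄, h₅, h₀, hs, he⟩ :=
    exists_vertices_of_length_six ((p.length_rotate u (by simpa using hu)).trans hl)
  have hp' := hp.rotate (by simpa using hu : u ∈ p.support)
  have hsub := p.toSubgraph_rotate (by simpa using hu : u ∈ p.support)
  have hn : [u, v₁, v₂, v₃, v₄, v₅].Nodup := by
    have := hp'.support_nodup
    rw [hs] at this
    simp only [List.tail_cons, List.nodup_cons, List.mem_cons, List.not_mem_nil, or_false,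
      not_or] at this ⊢
    grind
  have hv (v) : v ∈ p.toSubgraph.verts ↔ v ∈ [u, v₁, v₂, v₃, v₄, v₅] := by
    rw [← hsub, Walk.mem_verts_toSubgraph, hs]
    simp only [List.mem_cons, List.not_mem_nil, or_false]
    tauto
  have hE (e) : e ∈ p.toSubgraph.edgeSet ↔ e ∈ [s(u, v₁), s(v₁, v₂), s(v₂, v₃), s(v₃, v₄),
      s(v₄, v₅), s(v₅, u)] := by
    rw [← hsub, Walk.mem_edges_toSubgraph, he]
  have c1 := hlev (j + 1) (by simp)
  have c2 := hlev (j + 2) (by simp)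
  have c3 := hlev (j + 3) (by simp)
  rw [countP_level hn hv] at c1 c2 c3
  simp only [List.countP_cons, List.countP_nil, decide_eq_true_eq, level_eq hcn, hlu] at c1 c2 c3
  have b1 := level_le_of_adj (c := c) h₁.symm
  have b2 := level_le_of_adj (c := c) h₀
  have b3 := level_le_of_adj (c := c) h₂.symm
  have b4 := level_le_of_adj (c := c) h₅
  have l₀ : (u⁻¹ c : ℕ) = j + 2 := by omega
  -- Both neighbours of `u` one level down would be `u * adjSwap (j + 1) _`, hence equal.
  have hne : ¬ ((v₁⁻¹ c : ℕ) = j + 1 ∧ (v₅⁻¹ c : ℕ) = j + 1) := by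
    rintro ⟨e1, e2⟩
    have := eq_mul_adjSwap_of_lt h₁ hj l₀ e1
    rw [← eq_mul_adjSwap_of_lt h₀.symm hj l₀ e2] at this
    simp only [List.nodup_cons, List.mem_cons, List.not_mem_nil, or_false, not_or] at hn
    tauto
  refine ⟨j, hj, u, rfl, l₀, ?_⟩
  have cases : ((v₁⁻¹ c : ℕ) = j + 2 ∧ (v₂⁻¹ c : ℕ) = j + 1 ∧ (v₃⁻¹ c : ℕ) = j ∧
      (v₄⁻¹ c : ℕ) = j ∧ (v₅⁻¹ c : ℕ) = j + 1) ∨ ((v₅⁻¹ c : ℕ) = j + 2 ∧ (v₄⁻¹ c : ℕ) = j + 1 ∧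
      (v₃⁻¹ c : ℕ) = j ∧ (v₂⁻¹ c : ℕ) = j ∧ (v₁⁻¹ c : ℕ) = j + 1) := by
    refine level_pattern ?_ ?_ ?_ (by omega) (by omega) b3 b4 hne
    · simp at c1 ⊢
      omega
    · simp at c2 ⊢
      omega
    · simp at c3 ⊢
      omega
  obtain ⟨l₁, l₂, l₃, l₄, l₅⟩ | ⟨l₁, l₂, l₃, l₄, l₅⟩ := cases
  · refine eq_hexagon_of_levels hC hn h₁ h₂ h₃ h₄ h₅ h₀ ?_ ?_ j hj l₀ l₁ l₂ l₃ l₄ l₅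
    · ext x
      rw [hv]
      simp
    · ext x
      rw [hE]
      simp
  · refine eq_hexagon_of_levels hC (v₁ := v₅) (v₂ := v₄) (v₃ := v₃) (v₄ := v₂) (v₅ := v₁) ?_
      h₀.symm h₅.symm h₄.symm h₃.symm h₂.symm h₁.symm ?_ ?_ j hj l₀ l₁ l₂ l₃ l₄ l₅
    · simp only [List.nodup_cons, List.mem_cons, List.not_mem_nil, or_false, not_or] at hn ⊢
      grind
    · ext x
      rw [hv]
      simp only [List.mem_cons, List.not_mem_nil, or_false, Set.mem_insert_iff,
        Set.mem_singleton_iff]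
      tauto
    · ext x
      rw [hE]
      simp only [List.mem_cons, List.not_mem_nil, or_false, Set.mem_insert_iff,
        Set.mem_singleton_iff]
      rw [Sym2.eq_swap (a := u) (b := v₅), Sym2.eq_swap (a := v₅) (b := v₄),
        Sym2.eq_swap (a := v₄) (b := v₃), Sym2.eq_swap (a := v₃) (b := v₂),
        Sym2.eq_swap (a := v₂) (b := v₁), Sym2.eq_swap (a := v₁) (b := u)]
      exact or_six_reverse

end Level

/-! ### The complete invariant of a class and its possible values. -/

section Blocks

variable {n : ℕ}

/-- Sorting a descent at `k` strictly increases `∑ x π(x)`; this is the potential for the induction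
below. -/
theorem sum_mul_adjSwap (π : Equiv.Perm (Fin n)) (k : ℕ) (h : k + 1 < n) :
    ∑ x : Fin n, (x : ℤ) * ((π * adjSwap k h) x : ℕ) =
      ∑ x : Fin n, (x : ℤ) * (π x : ℕ) + ((π ⟨k, Nat.lt_of_succ_lt h⟩ : ℕ) - (π ⟨k + 1, h⟩ : ℕ)) := by
  have e : ∑ x : Fin n, (x : ℤ) * ((π * adjSwap k h) x : ℕ) =
      ∑ x : Fin n, ((adjSwap k h x : ℕ) : ℤ) * (π x : ℕ) := by
    rw [← Equiv.sum_comp (adjSwap k h)]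
    refine Finset.sum_congr rfl fun x _ => ?_
    rw [Equiv.Perm.mul_apply, ← Equiv.Perm.mul_apply (adjSwap k h), adjSwap_mul_self,
      Equiv.Perm.one_apply]
  have e2 (x : Fin n) : ((adjSwap k h x : ℕ) : ℤ) * (π x : ℕ) = (x : ℤ) * (π x : ℕ) +
      ((if x = ⟨k, Nat.lt_of_succ_lt h⟩ then ((π x : ℕ) : ℤ) else 0) -
        (if x = ⟨k + 1, h⟩ then ((π x : ℕ) : ℤ) else 0)) := by
    rw [adjSwap_val]
    simp only [Fin.ext_iff]
    split_ifs with h1 h2 h2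
    · omega
    · rw [h1]
      push_cast
      ring
    · rw [h2]
      push_cast
      ring
    · ring
  rw [e, Finset.sum_congr rfl fun x _ => e2 x, Finset.sum_add_distrib, Finset.sum_sub_distrib]
  simp

/-- The permutations which preserve a partition of `Fin n` into intervals are products of simple
transpositions inside the intervals. -/
theorem perm_block_induction {β : Fin n → ℕ} (hβ : Monotone β) {P : Equiv.Perm (Fin n) → Prop}
    (h1 : P 1) (hs : ∀ (π : Equiv.Perm (Fin n)) (k : ℕ) (h : k + 1 < n),
      β ⟨k, Nat.lt_of_succ_lt h⟩ = β ⟨k + 1, h⟩ → P π → P (π * adjSwap k h))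
    (π : Equiv.Perm (Fin n)) (hπ : ∀ x, β (π x) = β x) : P π := by
  classical
  by_contra hP
  obtain ⟨π, hmem, hmax⟩ := Finset.exists_max_image
    (Finset.univ.filter fun π : Equiv.Perm (Fin n) => (∀ x, β (π x) = β x) ∧ ¬ P π)
    (fun π => ∑ x : Fin n, (x : ℤ) * (π x : ℕ)) ⟨π, by simp [hP, hπ]⟩
  simp only [Finset.mem_filter, Finset.mem_univ, true_and] at hmem hmax
  obtain ⟨hπ, hP⟩ := hmem
  by_cases hd : ∃ (k : ℕ) (h : k + 1 < n), π ⟨k + 1, h⟩ < π ⟨k, Nat.lt_of_succ_lt h⟩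
  · obtain ⟨k, h, hk⟩ := hd
    -- A block-preserving permutation is increasing across block boundaries, so a descent lies
    -- inside a block.
    have hβk : β ⟨k, Nat.lt_of_succ_lt h⟩ = β ⟨k + 1, h⟩ := by
      refine le_antisymm (hβ (by simp [Fin.le_def])) ?_
      rw [← hπ, ← hπ ⟨k, _⟩]
      exact hβ hk.le
    have hπ' : ∀ x, β ((π * adjSwap k h) x) = β x := by
      intro x
      rw [Equiv.Perm.mul_apply, hπ]
      by_cases hx : (x : ℕ) = k
      · obtain rfl : x = ⟨k, Nat.lt_of_succ_lt h⟩ := Fin.ext hx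
        rw [adjSwap_left, hβk]
      by_cases hx' : (x : ℕ) = k + 1
      · obtain rfl : x = ⟨k + 1, h⟩ := Fin.ext hx'
        rw [adjSwap, Equiv.swap_apply_right, hβk]
      · rw [adjSwap_of_ne h hx hx']
    by_cases hP' : P (π * adjSwap k h)
    · apply hP
      have := hs _ k h hβk hP'
      rwa [mul_adjSwap_mul_self] at this
    · have := hmax _ ⟨hπ', hP'⟩
      rw [sum_mul_adjSwap] at this
      rw [Fin.lt_def] at hk
      omega
  · apply hP
    push Not at hd
    have : π = 1 := by
      have hm : StrictMono π := by
        cases n with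
        | zero => exact fun a => a.elim0
        | succ n =>
          rw [Fin.strictMono_iff_lt_succ]
          intro i
          refine lt_of_le_of_ne (hd i (by omega)) fun e => ?_
          have := π.injective e
          simp [Fin.ext_iff] at this
      have : ⇑π = id := (hm.range_inj strictMono_id).1 (by simp)
      ext x
      rw [this]
      rfl
    rwa [this]

theorem gammaB_connected (n : ℕ) : (gammaB n).Connected := by
  refine (connected_iff _).2 ⟨fun σ τ => ?_, ⟨1⟩⟩
  have := perm_block_induction (β := fun _ : Fin n => 0) (fun _ _ _ => le_rfl)
    (P := fun π => (gammaB n).Reachable σ (σ * π)) (by rw [mul_one])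
    (fun π k h _ H => H.trans (by rw [← mul_assoc]; exact (gammaB_adj_mul _ k h).reachable))
    (σ⁻¹ * τ) fun _ => rfl
  rwa [mul_inv_cancel_left] at this

/-- The reverse inclusion comes from multiplying by the involution `s_k` once more, so symmetry and
transitivity of `CyclesGHomotopic` are never needed. -/
theorem sixCycleClass_hexagon_mul (σ₀ σ : Equiv.Perm (Fin n)) {j : ℕ} (hj : j + 2 < n) {k : ℕ}
    (hk : k + 1 < n) (h : k + 1 < j ∨ k = j ∨ j + 2 < k) :
    sixCycleClass σ₀ (hexagon (σ * adjSwap k hk) j hj) = sixCycleClass σ₀ (hexagon σ j hj) := by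
  by_cases hkj : k = j
  · subst hkj
    rw [hexagon_mul_adjSwap_self]
  · replace h : k + 1 < j ∨ j + 2 < k := by omega
    ext D
    refine and_congr_right fun _ => ⟨fun H => ?_, cyclesGHomotopic_hexagon_mul hk h⟩
    have := cyclesGHomotopic_hexagon_mul hk h H
    rwa [mul_adjSwap_mul_self] at this

/-- The block of a position: before `j`, in `{j, j + 1}`, at `j + 2`, after `j + 2`. -/
def posBlock (j x : ℕ) : ℕ :=
  if x < j then 0 else if x < j + 2 then 1 else if x = j + 2 then 2 else 3

theorem posBlock_mono (j : ℕ) : Monotone (posBlock j) := by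
  intro x y h
  unfold posBlock
  split_ifs <;> omega

/-- The values to the left of position `j + 2` and those in positions `j` and `j + 1`. -/
def hexInvariant (σ : Equiv.Perm (Fin n)) (j : ℕ) : (_ : Finset (Fin n)) × Finset (Fin n) :=
  ⟨Finset.univ.filter fun v => (σ⁻¹ v : ℕ) < j + 2,
    Finset.univ.filter fun v => j ≤ (σ⁻¹ v : ℕ) ∧ (σ⁻¹ v : ℕ) < j + 2⟩

theorem hexInvariant_eq_iff {σ τ : Equiv.Perm (Fin n)} {j k : ℕ} :
    hexInvariant σ j = hexInvariant τ k ↔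
      (∀ v, (σ⁻¹ v : ℕ) < j + 2 ↔ (τ⁻¹ v : ℕ) < k + 2) ∧
      (∀ v, j ≤ (σ⁻¹ v : ℕ) ∧ (σ⁻¹ v : ℕ) < j + 2 ↔ k ≤ (τ⁻¹ v : ℕ) ∧ (τ⁻¹ v : ℕ) < k + 2) := by
  rw [hexInvariant, hexInvariant, Sigma.mk.injEq, heq_eq_eq, Finset.ext_iff, Finset.ext_iff]
  simp only [Finset.mem_filter, Finset.mem_univ, true_and]

theorem sixCycleClass_eq_of_hexInvariant_eq (σ₀ : Equiv.Perm (Fin n)) {σ τ : Equiv.Perm (Fin n)}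
    {j : ℕ} (hj : j + 2 < n) {c : Fin n} (hσ : (σ⁻¹ c : ℕ) = j + 2) (hτ : (τ⁻¹ c : ℕ) = j + 2)
    (h : hexInvariant σ j = hexInvariant τ j) :
    sixCycleClass σ₀ (hexagon σ j hj) = sixCycleClass σ₀ (hexagon τ j hj) := by
  rw [hexInvariant_eq_iff] at h
  have key := perm_block_induction (β := fun x : Fin n => posBlock j x)
    (fun _ _ h => posBlock_mono j h)
    (P := fun π => sixCycleClass σ₀ (hexagon (σ * π) j hj) = sixCycleClass σ₀ (hexagon σ j hj))
    (by rw [mul_one])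
    (fun π k hk hβ H => by
      rw [← mul_assoc, sixCycleClass_hexagon_mul σ₀ _ hj hk, H]
      simp only [posBlock] at hβ
      split_ifs at hβ <;> omega)
    -- At the position `x = τ⁻¹ v` this permutation takes the value `σ⁻¹ v`; the equal invariants
    -- and the common position of `c` say that both lie in the same block.
    (σ⁻¹ * τ) fun x => by
      obtain ⟨v, rfl⟩ := τ⁻¹.surjective x
      have h1 := h.1 v
      have h2 := h.2 v
      have h3 : (σ⁻¹ v : ℕ) = j + 2 ↔ (τ⁻¹ v : ℕ) = j + 2 := by
        rw [← hσ, ← Fin.ext_iff, hσ, ← hτ, ← Fin.ext_iff, σ⁻¹.injective.eq_iff,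
          τ⁻¹.injective.eq_iff]
      rw [← Equiv.Perm.mul_apply, mul_inv_cancel_right]
      unfold posBlock
      split_ifs <;> omega
  rw [mul_inv_cancel_left] at key
  exact key.symm

/-- The cocycle is built from the data of `σ` itself, so it has weight 1 on the first hexagon, hence
on the second, and this reveals the invariant of `τ`. The equality `j = k` is not assumed. -/
theorem hexInvariant_eq_of_cyclesGHomotopic {σ₀ σ τ : Equiv.Perm (Fin n)} {j k : ℕ}
    (hj : j + 2 < n) (hk : k + 2 < n) {c : Fin n} (hσ : (σ⁻¹ c : ℕ) = j + 2)
    (hτ : (τ⁻¹ c : ℕ) = k + 2)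
    (h : CyclesGHomotopic σ₀ (hexagon σ j hj) (hexagon τ k hk)) :
    hexInvariant σ j = hexInvariant τ k := by
  obtain ⟨a, ha⟩ : ∃ a, (σ⁻¹ a : ℕ) = j := ⟨σ ⟨j, by omega⟩, by simp⟩
  obtain ⟨b, hb⟩ : ∃ b, (σ⁻¹ b : ℕ) = j + 1 := ⟨σ ⟨j + 1, by omega⟩, by simp⟩
  have hab : a ≠ b := by
    rintro rfl
    omega
  have hca : c ≠ a := by
    rintro rfl
    omega
  have hcb : c ≠ b := by
    rintro rfl
    omega
  have hcL : c ∉ leftOf a b σ := by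
    simp only [leftOf, Set.mem_ofPred_eq, Fin.lt_def]
    omega
  have key := h.edgeWeight_eq (isSquareCocycle_crossingWeight hab (leftOf a b σ))
  rw [edgeWeight_hexagon hab hca hcb hcL σ j hj hσ, edgeWeight_hexagon hab hca hcb hcL τ k hk hτ,
    if_pos ⟨Or.inl ⟨ha, hb⟩, rfl⟩] at key
  by_cases H : ((((τ⁻¹ a : ℕ) = k ∧ (τ⁻¹ b : ℕ) = k + 1) ∨
    ((τ⁻¹ a : ℕ) = k + 1 ∧ (τ⁻¹ b : ℕ) = k)) ∧ leftOf a b τ = leftOf a b σ)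
  swap
  · rw [if_neg H] at key
    exact absurd key one_ne_zero
  obtain ⟨hp, hL⟩ := H
  have inj (ρ : Equiv.Perm (Fin n)) (x y : Fin n) : (ρ⁻¹ x : ℕ) = ρ⁻¹ y ↔ x = y := by
    rw [← Fin.ext_iff, ρ⁻¹.injective.eq_iff]
  rw [hexInvariant_eq_iff, ← forall_and]
  intro v
  have h1 : v ∈ leftOf a b τ ↔ v ∈ leftOf a b σ := by rw [hL]
  simp only [leftOf, Set.mem_ofPred_eq, Fin.lt_def] at h1
  have s1 := inj σ v a
  have s2 := inj σ v b
  have t1 := inj τ v a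
  have t2 := inj τ v b
  omega

theorem card_posBlock_fiber (j k : ℕ) (hj : j + 2 < n) :
    (Finset.univ.filter fun x : Fin n => posBlock j x = k).card =
      if k = 0 then j else if k = 1 then 2 else if k = 2 then 1 else
        if k = 3 then n - (j + 3) else 0 := by
  rw [Finset.card_filter, Fin.sum_univ_eq_sum_range (fun x => if posBlock j x = k then 1 else 0),
    ← Finset.card_filter]
  have key : (Finset.range n).filter (fun x => posBlock j x = k) =
      if k = 0 then Finset.range j else if k = 1 then Finset.Ico j (j + 2) else
        if k = 2 then {j + 2} else if k = 3 then Finset.Ico (j + 3) n else ∅ := by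
    ext x
    rw [Finset.mem_filter, Finset.mem_range, posBlock]
    split_ifs <;> simp <;> omega
  rw [key]
  split_ifs <;> simp

/-- Every admissible invariant is the invariant of a permutation. -/
theorem exists_hexInvariant_eq {c : Fin n} {j : ℕ} (hj : j + 2 < n) {U D : Finset (Fin n)}
    (hc : c ∉ U) (hU : U.card = j + 2) (hDU : D ⊆ U) (hD : D.card = 2) :
    ∃ σ : Equiv.Perm (Fin n), (σ⁻¹ c : ℕ) = j + 2 ∧ hexInvariant σ j = ⟨U, D⟩ := by
  -- `g` prescribes the position block of each value. Its fibres have the sizes of the blocks, so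
  -- matching fibres yields the required permutation.
  let g : Fin n → ℕ := fun v => if v ∈ U then if v ∈ D then 1 else 0 else if v = c then 2 else 3
  have hg (k : ℕ) : (Finset.univ.filter fun v => g v = k).card =
      if k = 0 then j else if k = 1 then 2 else if k = 2 then 1 else
        if k = 3 then n - (j + 3) else 0 := by
    have key : (Finset.univ.filter fun v => g v = k) = if k = 0 then U \ D else if k = 1 then D else
        if k = 2 then {c} else if k = 3 then (insert c U)ᶜ else ∅ := by
      ext v
      simp only [g, Finset.mem_filter, Finset.mem_univ, true_and]
      have := @hDU v
      by_cases h1 : v ∈ U <;> by_cases h2 : v ∈ D <;> by_cases h3 : v = c <;>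
        split_ifs <;> simp_all <;> omega
    rw [key]
    split_ifs
    · rw [Finset.card_sdiff_of_subset hDU]
      omega
    · exact hD
    · simp
    · rw [Finset.card_compl, Finset.card_insert_of_notMem hc, Fintype.card_fin, hU]
    · simp
  have e (k : ℕ) : Nonempty ({x : Fin n // posBlock j x = k} ≃ {v : Fin n // g v = k}) := by
    refine ⟨Fintype.equivOfCardEq ?_⟩
    rw [Fintype.card_subtype, Fintype.card_subtype, hg, card_posBlock_fiber j k hj]
  let σ : Equiv.Perm (Fin n) := Equiv.ofFiberEquiv fun k => (e k).some
  have hσ (v : Fin n) : g v = posBlock j (σ⁻¹ v : ℕ) := by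
    have := Equiv.ofFiberEquiv_map (fun k => (e k).some) (σ⁻¹ v)
    rw [← this]
    congr 1
    exact (σ.apply_symm_apply v).symm
  refine ⟨σ, ?_, ?_⟩
  · have := hσ c
    simp only [g, hc, if_false, if_true, posBlock] at this
    split_ifs at this <;> omega
  · rw [hexInvariant, Sigma.mk.injEq, heq_eq_eq]
    constructor <;> ext v <;> have := hσ v <;> have h2 := @hDU v <;>
      simp only [g, posBlock, Finset.mem_filter, Finset.mem_univ, true_and] at this ⊢ <;>
      split_ifs at this <;> simp_all <;> omega

theorem card_filter_inv_lt (σ : Equiv.Perm (Fin n)) {m : ℕ} (hm : m ≤ n) :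
    (Finset.univ.filter fun v => (σ⁻¹ v : ℕ) < m).card = m := by
  have : (Finset.univ.filter fun v => (σ⁻¹ v : ℕ) < m) =
      (Finset.univ.filter fun x : Fin n => (x : ℕ) < m).map σ.toEmbedding := by
    ext v
    simp only [Finset.mem_filter, Finset.mem_univ, true_and, Finset.mem_map, Equiv.coe_toEmbedding]
    refine ⟨fun h => ⟨σ⁻¹ v, h, by simp⟩, ?_⟩
    rintro ⟨x, hx, rfl⟩
    simpa using hx
  rw [this, Finset.card_map, Finset.card_filter,
    Fin.sum_univ_eq_sum_range (fun x => if x < m then 1 else 0), ← Finset.card_filter]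
  have : (Finset.range n).filter (fun x => x < m) = Finset.range m := by
    ext x
    simp only [Finset.mem_filter, Finset.mem_range]
    omega
  rw [this, Finset.card_range]

/-- The invariants of the vertical 6-cycles at level `i`. -/
def hexInvariants (c : Fin n) (i : ℕ) : Finset ((_ : Finset (Fin n)) × Finset (Fin n)) :=
  (Finset.powersetCard i (Finset.univ.erase c)).sigma fun U => Finset.powersetCard 2 U

theorem card_hexInvariants (c : Fin n) (i : ℕ) :
    (hexInvariants c i).card = (n - 1).choose i * i.choose 2 := by
  rw [hexInvariants, Finset.card_sigma, Finset.sum_congr rfl fun U hU => by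
    rw [Finset.card_powersetCard, (Finset.mem_powersetCard.1 hU).2], Finset.sum_const,
    Finset.card_powersetCard, Finset.card_erase_of_mem (Finset.mem_univ c), Finset.card_univ,
    Fintype.card_fin, smul_eq_mul]

theorem hexInvariant_mem {c : Fin n} {σ : Equiv.Perm (Fin n)} {j : ℕ} (hj : j + 2 < n)
    (hσ : (σ⁻¹ c : ℕ) = j + 2) : hexInvariant σ j ∈ hexInvariants c (j + 2) := by
  simp only [hexInvariants, hexInvariant, Finset.mem_sigma, Finset.mem_powersetCard]
  refine ⟨⟨fun v hv => ?_, card_filter_inv_lt σ hj.le⟩, fun v hv => ?_, ?_⟩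
  · simp only [Finset.mem_filter, Finset.mem_univ, true_and, Finset.mem_erase, and_true] at hv ⊢
    rintro rfl
    omega
  · simp only [Finset.mem_filter, Finset.mem_univ, true_and] at hv ⊢
    exact hv.2
  · have : (Finset.univ.filter fun v => j ≤ (σ⁻¹ v : ℕ) ∧ (σ⁻¹ v : ℕ) < j + 2) =
        (Finset.univ.filter fun v => (σ⁻¹ v : ℕ) < j + 2) \
          (Finset.univ.filter fun v => (σ⁻¹ v : ℕ) < j) := by
      ext v
      simp only [Finset.mem_filter, Finset.mem_univ, true_and, Finset.mem_sdiff]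
      omega
    rw [this, Finset.card_sdiff_of_subset, card_filter_inv_lt σ hj.le,
      card_filter_inv_lt σ (by omega)]
    · omega
    · intro v
      simp only [Finset.mem_filter, Finset.mem_univ, true_and]
      omega

end Blocks

/-! ### Counting the classes. -/

theorem ncard_image_eq_of_iff {α β γ : Type*} {Q : Set α} {f : α → β} {g : α → γ}
    (h : ∀ x ∈ Q, ∀ y ∈ Q, f x = f y ↔ g x = g y) : (f '' Q).ncard = (g '' Q).ncard := by
  refine Set.ncard_congr (fun b hb => g hb.choose) ?_ ?_ ?_
  · intro b hb
    exact ⟨_, hb.choose_spec.1, rfl⟩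
  · intro b b' hb hb' e
    rw [← h _ hb.choose_spec.1 _ hb'.choose_spec.1] at e
    rwa [hb.choose_spec.2, hb'.choose_spec.2] at e
  · rintro _ ⟨x, hx, rfl⟩
    have hb : f x ∈ f '' Q := ⟨x, hx, rfl⟩
    exact ⟨f x, hb, (h _ hb.choose_spec.1 _ hx).1 hb.choose_spec.2⟩

section Count

variable {n : ℕ}

/-- The pairs `(j, σ)` such that `σ` is a vertex of highest level of a vertical 6-cycle. -/
def topVertices (c : Fin n) : Set (ℕ × Equiv.Perm (Fin n)) :=
  {q | q.1 + 2 < n ∧ (q.2⁻¹ c : ℕ) = q.1 + 2}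

open Classical in
/-- The class of the vertical 6-cycle with a given vertex of highest level. -/
noncomputable def topClass (σ₀ : Equiv.Perm (Fin n)) (q : ℕ × Equiv.Perm (Fin n)) :
    Set (gammaB n).Subgraph :=
  if h : q.1 + 2 < n then sixCycleClass σ₀ (hexagon q.2 q.1 h) else ∅

theorem topClass_eq_iff (σ₀ : Equiv.Perm (Fin n)) {c : Fin n} {q r : ℕ × Equiv.Perm (Fin n)}
    (hq : q ∈ topVertices c) (hr : r ∈ topVertices c) :
    topClass σ₀ q = topClass σ₀ r ↔ hexInvariant q.2 q.1 = hexInvariant r.2 r.1 := by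
  obtain ⟨j, σ⟩ := q
  obtain ⟨k, τ⟩ := r
  obtain ⟨hj, hσ⟩ := hq
  obtain ⟨hk, hτ⟩ := hr
  simp only at hj hσ hk hτ
  simp only [topClass, hj, hk, dif_pos]
  constructor
  · intro h
    -- Reflexivity, which uses connectedness to reach the cycle from `σ₀`, turns equality of classes
    -- into an actual homotopy.
    have mem : hexagon τ k hk ∈ sixCycleClass σ₀ (hexagon τ k hk) :=
      ⟨isPrimitiveSixCycle_hexagon τ k hk hτ,
        CyclesGHomotopic.refl (gammaB_connected n) (isCycleOfLength_hexagon τ k hk)⟩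
    rw [← h] at mem
    exact hexInvariant_eq_of_cyclesGHomotopic hj hk hσ hτ mem.2
  · intro h
    have h1 := (Finset.mem_powersetCard.1 (Finset.mem_sigma.1 (hexInvariant_mem hj hσ)).1).2
    have h2 := (Finset.mem_powersetCard.1 (Finset.mem_sigma.1 (hexInvariant_mem hk hτ)).1).2
    rw [h, h2] at h1
    obtain rfl : k = j := by omega
    exact sixCycleClass_eq_of_hexInvariant_eq σ₀ hj hσ hτ h

theorem verticalClassesAt_eq_image (σ₀ : Equiv.Perm (Fin n)) {c : Fin n} (hcn : (c : ℕ) + 1 = n)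
    (i : ℕ) : verticalClassesAt σ₀ i = topClass σ₀ '' {q ∈ topVertices c | q.1 + 2 = i} := by
  ext S
  constructor
  · rintro ⟨C, hC, rfl⟩
    obtain ⟨j, hj, σ, rfl, hσ, rfl⟩ := hC.exists_eq_hexagon hcn
    exact ⟨(j, σ), ⟨⟨hj, hσ⟩, rfl⟩, by simp [topClass, hj]⟩
  · rintro ⟨⟨j, σ⟩, ⟨⟨hj, hσ⟩, rfl⟩, rfl⟩
    simp only at hj hσ
    exact ⟨hexagon σ j hj, isVerticalAt_hexagon hcn σ j hj hσ, by simp [topClass, hj]⟩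

theorem verticalClasses_eq_image (σ₀ : Equiv.Perm (Fin n)) {c : Fin n} (hcn : (c : ℕ) + 1 = n) :
    verticalClasses σ₀ = topClass σ₀ '' topVertices c := by
  have : verticalClasses σ₀ = ⋃ i, verticalClassesAt σ₀ i := by
    ext S
    simp [verticalClasses, verticalClassesAt]
  rw [this]
  simp only [verticalClassesAt_eq_image σ₀ hcn, ← Set.image_iUnion]
  congr 1
  ext q
  simp

theorem image_hexInvariant {c : Fin n} (i : ℕ) (h2 : 2 ≤ i) (hi : i + 1 ≤ n) :
    (fun q : ℕ × Equiv.Perm (Fin n) => hexInvariant q.2 q.1) ''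
      {q ∈ topVertices c | q.1 + 2 = i} = (hexInvariants c i : Set _) := by
  ext ⟨U, D⟩
  constructor
  · rintro ⟨⟨j, σ⟩, ⟨⟨hj, hσ⟩, rfl⟩, h⟩
    rw [← h]
    exact hexInvariant_mem hj hσ
  · intro h
    simp only [hexInvariants, Finset.coe_sigma, Set.mem_sigma_iff, Finset.mem_coe,
      Finset.mem_powersetCard] at h
    obtain ⟨j, rfl⟩ : ∃ j, i = j + 2 := ⟨i - 2, by omega⟩
    obtain ⟨σ, hσ, h'⟩ := exists_hexInvariant_eq (c := c) (j := j) (by omega)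
      (fun hc => by simpa using h.1.1 hc) h.1.2 h.2.1 h.2.2
    exact ⟨(j, σ), ⟨⟨by simp only; omega, hσ⟩, rfl⟩, h'⟩

theorem ncard_verticalClassesAt (σ₀ : Equiv.Perm (Fin n)) {i : ℕ} (h2 : 2 ≤ i) (hi : i + 1 ≤ n) :
    (verticalClassesAt σ₀ i).ncard = (n - 1).choose i * i.choose 2 := by
  have hcn : ((⟨n - 1, by omega⟩ : Fin n) : ℕ) + 1 = n := by simp only; omega
  rw [verticalClassesAt_eq_image σ₀ hcn, ncard_image_eq_of_iff fun x hx y hy =>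
    topClass_eq_iff σ₀ hx.1 hy.1, image_hexInvariant i h2 hi, Set.ncard_coe_finset,
    card_hexInvariants]

theorem ncard_verticalClasses (hn : 3 ≤ n) (σ₀ : Equiv.Perm (Fin n)) :
    (verticalClasses σ₀).ncard = ∑ i ∈ Finset.Icc 2 (n - 1), (verticalClassesAt σ₀ i).ncard := by
  classical
  have hcn : ((⟨n - 1, by omega⟩ : Fin n) : ℕ) + 1 = n := by simp only; omega
  set c : Fin n := ⟨n - 1, by omega⟩
  have key : (fun q : ℕ × Equiv.Perm (Fin n) => hexInvariant q.2 q.1) '' topVertices c =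
      ((Finset.Icc 2 (n - 1)).biUnion (hexInvariants c) : Set _) := by
    have : topVertices c = ⋃ i ∈ Finset.Icc 2 (n - 1), {q ∈ topVertices c | q.1 + 2 = i} := by
      ext q
      simp only [Set.mem_iUnion, Set.mem_ofPred_eq, Finset.mem_Icc, exists_prop]
      refine ⟨fun h => ⟨_, ⟨by omega, ?_⟩, h, rfl⟩, fun ⟨_, _, h, _⟩ => h⟩
      have := h.1
      omega
    rw [this, Set.image_iUnion₂, Finset.coe_biUnion]
    refine Set.iUnion₂_congr fun i hi => ?_
    rw [Finset.mem_Icc] at hi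
    exact image_hexInvariant i hi.1 (by omega)
  rw [verticalClasses_eq_image σ₀ hcn, ncard_image_eq_of_iff fun x hx y hy =>
    topClass_eq_iff σ₀ hx hy, key, Set.ncard_coe_finset, Finset.card_biUnion]
  · refine Finset.sum_congr rfl fun i hi => ?_
    rw [Finset.mem_Icc] at hi
    rw [card_hexInvariants, ncard_verticalClassesAt σ₀ hi.1 (by omega)]
  -- The level is recovered from the invariant as the size of `U`.
  · intro i _ k _ hik
    rw [Function.onFun, Finset.disjoint_left]
    rintro ⟨U, D⟩ h1 h2
    simp only [hexInvariants, Finset.mem_sigma, Finset.mem_powersetCard] at h1 h2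
    exact hik (h1.1.2.symm.trans h2.1.2)

end Count

/-- Choosing the 2-subset first leaves an arbitrary subset of the other `n - 3` values. -/
theorem sum_choose_mul_choose_two {n : ℕ} (hn : 3 ≤ n) :
    ∑ i ∈ Finset.Icc 2 (n - 1), (n - 1).choose i * i.choose 2 = 2 ^ (n - 3) * (n - 1).choose 2 := by
  obtain ⟨m, rfl⟩ : ∃ m, n = m + 3 := ⟨n - 3, by omega⟩
  have : Finset.Icc 2 (m + 3 - 1) = (Finset.range (m + 1)).map (addRightEmbedding 2) := by
    rw [Finset.range_eq_Ico, Finset.map_add_right_Ico]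
    ext x
    simp only [Finset.mem_Icc, Finset.mem_Ico]
    omega
  rw [this, Finset.sum_map]
  simp only [addRightEmbedding_apply]
  rw [Finset.sum_congr rfl fun x _ => Nat.choose_mul (by omega : 2 ≤ x + 2)]
  simp only [Nat.add_sub_cancel, ← Finset.mul_sum]
  rw [show m + 3 - 1 - 2 = m by omega, Nat.sum_range_choose, mul_comm]

theorem choose_mul_choose_two_eq_div {n i : ℕ} (h2 : 2 ≤ i) (hi : i + 1 ≤ n) :
    (((n - 1).choose i * i.choose 2 : ℕ) : ℚ) = (Nat.factorial (n - 1) : ℚ) /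
      (2 * (Nat.factorial (i - 2) : ℚ) * (Nat.factorial (n - i - 1) : ℚ)) := by
  rw [Nat.cast_mul, Nat.cast_choose ℚ (by omega : i ≤ n - 1), Nat.cast_choose ℚ h2,
    show n - 1 - i = n - i - 1 by omega]
  have := Nat.factorial_ne_zero i
  field_simp
  simp

end DiscreteHomotopy

theorem corollary5p5 (n : ℕ) (hn : 3 ≤ n) (σ₀ : Equiv.Perm (Fin n)) :
    (∀ i : ℕ, 2 ≤ i → i + 1 ≤ n →
      ((DiscreteHomotopy.verticalClassesAt σ₀ i).ncard : ℚ) =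
          (Nat.factorial (n - 1) : ℚ) /
            (2 * (Nat.factorial (i - 2) : ℚ) * (Nat.factorial (n - i - 1) : ℚ)) ∧
        (DiscreteHomotopy.verticalClassesAt σ₀ i).ncard =
          Nat.choose (n - 1) i * Nat.choose i 2) ∧
    (DiscreteHomotopy.verticalClasses σ₀).ncard =
        ∑ i ∈ Finset.Icc 2 (n - 1), (DiscreteHomotopy.verticalClassesAt σ₀ i).ncard ∧
    (DiscreteHomotopy.verticalClasses σ₀).ncard = 2 ^ (n - 3) * Nat.choose (n - 1) 2 := by
  refine ⟨fun i h2 hi => ?_, DiscreteHomotopy.ncard_verticalClasses hn σ₀, ?_⟩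
  · rw [DiscreteHomotopy.ncard_verticalClassesAt σ₀ h2 hi]
    exact ⟨DiscreteHomotopy.choose_mul_choose_two_eq_div h2 hi, rfl⟩
  · rw [DiscreteHomotopy.ncard_verticalClasses hn σ₀,
      ← DiscreteHomotopy.sum_choose_mul_choose_two hn]
    refine Finset.sum_congr rfl fun i hi => ?_
    rw [Finset.mem_Icc] at hi
    exact DiscreteHomotopy.ncard_verticalClassesAt σ₀ hi.1 (by omega)
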